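/- Let $S^1=\mathbb R/\mathbb Z$ with its arc-length metric, and let $a,b$ be real numbers with $0<a<\log 2<b$. Then there exists a continuous piecewise linear expanding map $g:S^1\to S^1$ of degree $2$ that is \emph{well-behaved}, i.e. has a unique invariant Borel probability measure $\mu_{abs}$ that is absolutely continuous with respect to Lebesgue measure, such that \[ \lambda_{abs}(g):=\int_{S^1}\log|g'|\,d\mu_{abs}=a \qquad\text{and}\qquad \lambda_{max}(g):=\int_{S^1}\log|g'|\,d\mu_{max}=b . \] Here $\mu_{max}$ is the measure of maximal entropy of $g$, i.e. the $g$-invariant Borel probability measure at which the metric (Kolmogorov--Sinai) entropy $h_\mu(g)$ attains its supremum over all $g$-invariant Borel probability measures; the claim includes that $\mu_{max}$ exists and is unique, and that $g$ is differentiable almost everywhere and $\log|g'|$ is integrable with respect to both measures. ``Piecewise linear'' means that a continuous lift $\mathbb R\to\mathbb R$ of $g$ is affine on each interval of a finite subdivision of $[0,1]$; ``expanding'' means that there are $r>1$ and $\varepsilon>0$ with $d(g(x),g(y))>r\,d(x,y)$ whenever $0<d(x,y)<\varepsilon$. -/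

import Mathlib

open MeasureTheory Filter Topology

noncomputable section

/-- `F : ℝ → ℝ` is a (continuous) lift of the map `g` of the circle `ℝ / ℤ`. -/
def IsLift (F : ℝ → ℝ) (g : UnitAddCircle → UnitAddCircle) : Prop :=
  Continuous F ∧ ∀ x : ℝ, ((F x : ℝ) : UnitAddCircle) = g (x : UnitAddCircle)

/-- The circle map `g` has degree `d`. -/
def HasDegree (g : UnitAddCircle → UnitAddCircle) (d : ℤ) : Prop :=
  ∃ F : ℝ → ℝ, IsLift F g ∧ ∀ x : ℝ, F (x + 1) = F x + d

/-- The circle map `g` is continuous and piecewise linear: some continuous lift is affine on each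
interval of a finite subdivision `0 = t 0 < t 1 < ⋯ < t m = 1`. -/
def IsPiecewiseLinear (g : UnitAddCircle → UnitAddCircle) : Prop :=
  ∃ F : ℝ → ℝ, IsLift F g ∧
    ∃ (m : ℕ) (t : Fin (m + 1) → ℝ), StrictMono t ∧ t 0 = 0 ∧ t (Fin.last m) = 1 ∧
      ∀ i : Fin m, ∃ s c : ℝ, ∀ x ∈ Set.Icc (t i.castSucc) (t i.succ), F x = s * x + c

/-- The map `g` is expanding: it uniformly expands small distances. The distance on `ℝ / ℤ` is
arc length. -/
def IsExpandingMap (g : UnitAddCircle → UnitAddCircle) : Prop :=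
  ∃ r > (1 : ℝ), ∃ ε > (0 : ℝ), ∀ x y : UnitAddCircle, x ≠ y → dist x y < ε →
    r * dist x y < dist (g x) (g y)

/-- The signed displacement `h ↦ g (x + h) - g x`, read in `(-1/2, 1/2]`. For small `h` it is
`F (t + h) - F t`, for a continuous lift `F` of `g` and a representative `t` of `x`. -/
def displacement (g : UnitAddCircle → UnitAddCircle) (x : UnitAddCircle) (h : ℝ) : ℝ :=
  (AddCircle.equivIoc (1 : ℝ) (-1 / 2) (g (x + (h : UnitAddCircle)) - g x) : ℝ)

/-- The derivative `g' x` of a circle map (meaningful where the displacement is differentiable). -/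
def circleDeriv (g : UnitAddCircle → UnitAddCircle) (x : UnitAddCircle) : ℝ :=
  deriv (displacement g x) 0

/-- The Lyapunov exponent `∫ log |g'| dμ` of `g` with respect to `μ` is well defined and equal
to `l`. -/
def HasLyapunovExponent (g : UnitAddCircle → UnitAddCircle) (μ : Measure UnitAddCircle)
    (l : ℝ) : Prop :=
  (∀ᵐ x ∂μ, DifferentiableAt ℝ (displacement g x) 0) ∧
    Integrable (fun x => Real.log |circleDeriv g x|) μ ∧
    ∫ x, Real.log |circleDeriv g x| ∂μ = l

/-- `μ` is a `g`-invariant Borel probability measure. -/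
def IsInvariantProbability {X : Type*} [MeasurableSpace X] (g : X → X) (μ : Measure X) : Prop :=
  IsProbabilityMeasure μ ∧ MeasurePreserving g μ μ

/-- Shannon entropy of the finite partition of `X` into the fibres of `p : X → ι`. -/
def partitionEntropy {X : Type*} [MeasurableSpace X] (μ : Measure X) {ι : Type*} [Fintype ι]
    (p : X → ι) : ℝ :=
  ∑ c : ι, Real.negMulLog (μ.real (p ⁻¹' {c}))

/-- The itinerary map, whose fibres form the join `⋁_{i < n} g⁻ⁱ P`, where `P` is the partition
into the fibres of `p`. -/
def itinerary {X ι : Type*} (g : X → X) (p : X → ι) (n : ℕ) (x : X) : Fin n → ι :=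
  fun i => p (g^[i] x)

/-- Entropy of `g` with respect to `μ` and the partition into the fibres of `p`. -/
def entropyOfPartition {X : Type*} [MeasurableSpace X] (g : X → X) (μ : Measure X) {k : ℕ}
    (p : X → Fin k) : EReal :=
  limsup (fun n : ℕ => ((partitionEntropy μ (itinerary g p n) / n : ℝ) : EReal)) atTop

/-- Metric (Kolmogorov–Sinai) entropy `h_μ(g)`: the supremum over all finite measurable
partitions. -/
def metricEntropy {X : Type*} [MeasurableSpace X] (g : X → X) (μ : Measure X) : EReal :=
  ⨆ (k : ℕ) (p : X → Fin k) (_ : Measurable p), entropyOfPartition g μ p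

/-- `μ` is a measure of maximal entropy: it attains the supremum of the metric entropy over all
invariant probability measures. -/
def IsMaximalEntropyMeasure {X : Type*} [MeasurableSpace X] (g : X → X) (μ : Measure X) : Prop :=
  IsInvariantProbability g μ ∧
    ∀ ν : Measure X, IsInvariantProbability g ν → metricEntropy g ν ≤ metricEntropy g μ

/-- `μ` is an invariant probability measure, absolutely continuous with respect to Lebesgue
measure. -/
def IsACInvariantProbability (g : UnitAddCircle → UnitAddCircle) (μ : Measure UnitAddCircle) :
    Prop :=
  IsInvariantProbability g μ ∧ μ ≪ (volume : Measure UnitAddCircle)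

/-- `g` is well-behaved: it has a unique absolutely continuous invariant probability measure. -/
def IsWellBehaved (g : UnitAddCircle → UnitAddCircle) : Prop :=
  ∃! μ : Measure UnitAddCircle, IsACInvariantProbability g μ

/-- `λ_abs(g) = l`: the absolutely continuous invariant probability measure of `g` exists, is
unique, and has Lyapunov exponent `l`. -/
def HasLambdaAbs (g : UnitAddCircle → UnitAddCircle) (l : ℝ) : Prop :=
  (∃! μ : Measure UnitAddCircle, IsACInvariantProbability g μ) ∧
    ∀ μ : Measure UnitAddCircle, IsACInvariantProbability g μ → HasLyapunovExponent g μ l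

/-- `λ_max(g) = l`: the measure of maximal entropy of `g` exists, is unique, and has Lyapunov
exponent `l`. -/
def HasLambdaMax (g : UnitAddCircle → UnitAddCircle) (l : ℝ) : Prop :=
  (∃! μ : Measure UnitAddCircle, IsMaximalEntropyMeasure g μ) ∧
    ∀ μ : Measure UnitAddCircle, IsMaximalEntropyMeasure g μ → HasLyapunovExponent g μ l

end

/-!
The map is built from its two inverse branches `f₀`, `f₁ : [0, 1] → [0, 1]`, chosen such that
`f₀' + f₁' = 1`. Then Lebesgue measure is invariant. With `f₀' = α` on `[0, p]` and `f₀' = γ` on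
`[p, 1]`, the exponent of Lebesgue measure is `p H(α) + (1 - p) H(γ)`, where `H` is the binary
entropy (`BranchParams.IsMarkov.hasLambdaAbs`).

The parameter `p` is tuned so that `[0, p)` is the cylinder of points whose first `n` symbols are
`0` (`BranchParams.isMarkov_of_eq`). The map is then affine on long cylinders, so an invariant set
of positive measure occupies a fixed proportion of every long cylinder. By the density theorem
along cylinders, which is Lévy's upward theorem, it has full measure. Hence Lebesgue measure is
ergodic (`BranchParams.IsMarkov.ergodic_volume`) and is the only absolutely continuous invariant
probability measure.

The semiconjugacy `lim Fⁿ / 2ⁿ` to the doubling map, for a lift `F`, is the distribution function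
of an invariant measure giving mass `2⁻ᵏ` to every `k`-cylinder. The Kolmogorov–Sinai theorem bounds
the entropy of any invariant measure by `1 / k` times the entropy of the partition into
`k`-cylinders (`metricEntropy_le_of_generator`). That is at most `log 2`, with equality for all `k`
only if all `k`-cylinders have mass `2⁻ᵏ`. So this is the unique measure of maximal entropy
(`isMaximalEntropyMeasure_iff_eq`). It gives mass `2⁻ⁿ` to `[0, p)`, hence its exponent is
`2⁻ⁿ φ(α) + (1 - 2⁻ⁿ) φ(γ)` with `φ(x) = -(log x + log (1 - x)) / 2`
(`BranchParams.IsMarkov.hasLambdaMax`).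

It remains to choose `n`, `α` and `γ`. For fixed `n` the equation `λ_max = b` defines a curve, along
which `α` runs from a tiny number `δ` to `1 - δ`, with `γ = 1/2` at both ends. At the first end `p`
is of order `2⁻ⁿ`, so `λ_abs` is close to `H(1/2) = log 2`. At the other end `δ` is so much smaller
than `2⁻ⁿ` that `p` is close to `1`, and `λ_abs` is close to `H(1 - δ)`, hence to `0`. The
intermediate value theorem gives `λ_abs = a` once `n` is large (`exists_markov_params`).
-/

/-! ### Shannon entropy of finite-valued maps -/

section Entropy

variable {X : Type*} [MeasurableSpace X] {α β γ : Type*} [Fintype β]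

/-- The masses of the fibres of `u` over a fibre of `φ` add up to the mass of the fibre of
`φ ∘ u`. -/
lemma sum_measureReal_fiber [DecidableEq α] [MeasurableSpace β] [MeasurableSingletonClass β]
    (ν : Measure X) [IsFiniteMeasure ν] {u : X → β} (hu : Measurable u) (φ : β → α) (a : α) :
    ν.real ((fun x => φ (u x)) ⁻¹' {a}) =
      ∑ b ∈ Finset.univ.filter (fun b => φ b = a), ν.real (u ⁻¹' {b}) := by
  have h : (fun x => φ (u x)) ⁻¹' {a} =
      ⋃ b ∈ Finset.univ.filter (fun b => φ b = a), u ⁻¹' {b} := by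
    ext x; simp
  rw [h, measureReal_biUnion_finset]
  · intro b _ b' _ hbb'
    exact Disjoint.preimage _ (by simpa using hbb')
  · intro b _
    exact hu (measurableSet_singleton b)

lemma sum_measureReal_preimage_singleton [MeasurableSpace β] [MeasurableSingletonClass β]
    (ν : Measure X) [IsProbabilityMeasure ν] {u : X → β} (hu : Measurable u) :
    ∑ b, ν.real (u ⁻¹' {b}) = 1 := by
  have h := sum_measureReal_fiber ν hu (fun _ => ()) ()
  simp only [Finset.filter_true] at h
  rw [← h]
  simp

/-- A map that factors through `u` has at most the entropy of `u`. -/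
lemma partitionEntropy_comp_le [Fintype α] [MeasurableSpace β] [MeasurableSingletonClass β]
    (ν : Measure X) [IsProbabilityMeasure ν] {u : X → β} (hu : Measurable u) (φ : β → α) :
    partitionEntropy ν (fun x => φ (u x)) ≤ partitionEntropy ν u := by
  classical
  unfold partitionEntropy
  rw [← Finset.sum_fiberwise (s := Finset.univ) (g := φ)]
  refine Finset.sum_le_sum fun a _ => ?_
  rw [sum_measureReal_fiber ν hu φ a, Real.negMulLog, neg_mul, Finset.sum_mul,
    ← Finset.sum_neg_distrib]
  refine Finset.sum_le_sum fun b hb => ?_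
  rcases (measureReal_nonneg (μ := ν) (s := u ⁻¹' {b})).eq_or_lt with h0 | hpos
  · simp [← h0]
  · rw [Real.negMulLog, neg_mul]
    have hle : ν.real (u ⁻¹' {b}) ≤
        ∑ b ∈ Finset.univ.filter (fun b => φ b = a), ν.real (u ⁻¹' {b}) :=
      Finset.single_le_sum (f := fun b => ν.real (u ⁻¹' {b}))
        (fun _ _ => measureReal_nonneg) hb
    have := Real.log_le_log hpos hle
    have := mul_le_mul_of_nonneg_left this hpos.le
    linarith

/-- Invariance of entropy under a measure-preserving map. -/
lemma partitionEntropy_comp_measurePreserving [MeasurableSpace β] [MeasurableSingletonClass β]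
    {ν : Measure X} {g : X → X} (hg : MeasurePreserving g ν ν) {u : X → β} (hu : Measurable u) :
    partitionEntropy ν (fun x => u (g x)) = partitionEntropy ν u := by
  unfold partitionEntropy
  refine Finset.sum_congr rfl fun b _ => ?_
  congr 1
  exact hg.measureReal_preimage (hu (measurableSet_singleton b)).nullMeasurableSet

/-- **Gibbs' inequality**, with the entropies written out. -/
lemma sum_mul_log_le_sum_mul_log {ι : Type*} (s : Finset ι) (x y : ι → ℝ)
    (hx : ∀ i ∈ s, 0 ≤ x i) (hy : ∀ i ∈ s, 0 ≤ y i) (hxy : ∀ i ∈ s, y i = 0 → x i = 0)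
    (hsum : ∑ i ∈ s, y i ≤ ∑ i ∈ s, x i) :
    ∑ i ∈ s, x i * Real.log (y i) ≤ ∑ i ∈ s, x i * Real.log (x i) := by
  have key : ∀ i ∈ s, x i * Real.log (y i) - x i * Real.log (x i) ≤ y i - x i := by
    intro i hi
    rcases (hx i hi).eq_or_lt with h0 | hpos
    · simp [← h0, hy i hi]
    · have hypos : 0 < y i := lt_of_le_of_ne (hy i hi) fun h => hpos.ne' (hxy i hi h.symm)
      have h1 := Real.log_le_sub_one_of_pos (div_pos hypos hpos)
      rw [Real.log_div hypos.ne' hpos.ne'] at h1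
      have h2 := mul_le_mul_of_nonneg_left h1 hpos.le
      have h3 : x i * (y i / x i - 1) = y i - x i := by field_simp
      linarith
  have := Finset.sum_le_sum key
  rw [Finset.sum_sub_distrib, Finset.sum_sub_distrib] at this
  linarith

/-- **Strong subadditivity** of Shannon entropy, `H(u,v,w) + H(w) ≤ H(u,w) + H(v,w)`. -/
lemma partitionEntropy_strong_subadditive [Fintype α] [Fintype γ] [MeasurableSpace α]
    [MeasurableSingletonClass α]
    [MeasurableSpace β] [MeasurableSingletonClass β] [MeasurableSpace γ]
    [MeasurableSingletonClass γ] (ν : Measure X) [IsProbabilityMeasure ν]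
    {u : X → α} {v : X → β} {w : X → γ} (hu : Measurable u) (hv : Measurable v)
    (hw : Measurable w) :
    partitionEntropy ν (fun x => (u x, v x, w x)) + partitionEntropy ν w ≤
      partitionEntropy ν (fun x => (u x, w x)) + partitionEntropy ν (fun x => (v x, w x)) := by
  classical
  set P : α → β → γ → ℝ := fun a b c => ν.real ((fun x => (u x, v x, w x)) ⁻¹' {(a, b, c)})
    with hP
  set A : α → γ → ℝ := fun a c => ν.real ((fun x => (u x, w x)) ⁻¹' {(a, c)}) with hA
  set B : β → γ → ℝ := fun b c => ν.real ((fun x => (v x, w x)) ⁻¹' {(b, c)}) with hB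
  set C : γ → ℝ := fun c => ν.real (w ⁻¹' {c}) with hC
  have hmeas : Measurable (fun x => (u x, v x, w x)) := hu.prodMk (hv.prodMk hw)
  have hAsum : ∀ a c, ∑ b, P a b c = A a c := by
    intro a c
    have h := sum_measureReal_fiber ν hmeas (fun t : α × β × γ => (t.1, t.2.2)) (a, c)
    simp only [hA]
    rw [h]
    refine Finset.sum_bij (fun b _ => (a, b, c)) (by simp) (by simp) ?_ (by simp [hP])
    rintro ⟨a', b', c'⟩ h
    simp only [Finset.mem_filter, Prod.mk.injEq] at h
    exact ⟨b', Finset.mem_univ _, by simp [h.2.1, h.2.2]⟩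
  have hBsum : ∀ b c, ∑ a, P a b c = B b c := by
    intro b c
    have h := sum_measureReal_fiber ν hmeas (fun t : α × β × γ => (t.2.1, t.2.2)) (b, c)
    simp only [hB]
    rw [h]
    refine Finset.sum_bij (fun a _ => (a, b, c)) (by simp) (by simp) ?_ (by simp [hP])
    rintro ⟨a', b', c'⟩ h
    simp only [Finset.mem_filter, Prod.mk.injEq] at h
    exact ⟨a', Finset.mem_univ _, by simp [h.2.1, h.2.2]⟩
  have hCA : ∀ c, ∑ a, A a c = C c := by
    intro c
    have h := sum_measureReal_fiber ν (hu.prodMk hw) (fun t : α × γ => t.2) c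
    simp only [hC]
    rw [h]
    refine Finset.sum_bij (fun a _ => (a, c)) (by simp) (by simp) ?_ (by simp [hA])
    rintro ⟨a', c'⟩ h
    simp only [Finset.mem_filter] at h
    exact ⟨a', Finset.mem_univ _, by simp [h.2]⟩
  have hCB : ∀ c, ∑ b, B b c = C c := by
    intro c
    have h := sum_measureReal_fiber ν (hv.prodMk hw) (fun t : β × γ => t.2) c
    simp only [hC]
    rw [h]
    refine Finset.sum_bij (fun a _ => (a, c)) (by simp) (by simp) ?_ (by simp [hB])
    rintro ⟨a', c'⟩ h
    simp only [Finset.mem_filter] at h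
    exact ⟨a', Finset.mem_univ _, by simp [h.2]⟩
  have hP0 : ∀ a b c, 0 ≤ P a b c := fun _ _ _ => measureReal_nonneg
  have hA0 : ∀ a c, 0 ≤ A a c := fun _ _ => measureReal_nonneg
  have hB0 : ∀ b c, 0 ≤ B b c := fun _ _ => measureReal_nonneg
  have hPA : ∀ a b c, P a b c ≤ A a c := fun a b c => by
    rw [← hAsum]; exact Finset.single_le_sum (f := fun b => P a b c) (fun _ _ => hP0 _ _ _)
      (Finset.mem_univ b)
  have hPB : ∀ a b c, P a b c ≤ B b c := fun a b c => by
    rw [← hBsum]; exact Finset.single_le_sum (f := fun a => P a b c) (fun _ _ => hP0 _ _ _)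
      (Finset.mem_univ a)
  have hAC : ∀ a c, A a c ≤ C c := fun a c => by
    rw [← hCA]; exact Finset.single_le_sum (f := fun a => A a c) (fun _ _ => hA0 _ _)
      (Finset.mem_univ a)
  -- Compare, over each value `c` of `w`, the joint law with the conditionally independent one.
  have main : ∀ c, ∑ t : α × β, P t.1 t.2 c * Real.log (A t.1 c * B t.2 c / C c) ≤
      ∑ t : α × β, P t.1 t.2 c * Real.log (P t.1 t.2 c) := by
    intro c
    refine sum_mul_log_le_sum_mul_log Finset.univ (fun t : α × β => P t.1 t.2 c)
      (fun t : α × β => A t.1 c * B t.2 c / C c) (fun _ _ => hP0 _ _ _)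
      (fun _ _ => div_nonneg (mul_nonneg (hA0 _ _) (hB0 _ _)) measureReal_nonneg) ?_ ?_
    · intro t _ h
      have h1 := hP0 t.1 t.2 c
      have h2 := hPA t.1 t.2 c
      have h3 := hPB t.1 t.2 c
      have h4 := hAC t.1 c
      rcases div_eq_zero_iff.1 h with h | h
      · rcases mul_eq_zero.1 h with h | h <;> linarith
      · linarith
    · rw [Fintype.sum_prod_type, Fintype.sum_prod_type]
      simp only [hAsum, ← Finset.sum_div, ← Finset.mul_sum, hCB]
      rw [← Finset.sum_mul, hCA]
      rcases eq_or_ne (C c) 0 with h | h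
      · simp [h]
      · rw [mul_div_assoc, div_self h, mul_one]
  have split : ∀ c, ∑ t : α × β, P t.1 t.2 c * Real.log (A t.1 c * B t.2 c / C c) =
      ∑ a, A a c * Real.log (A a c) + ∑ b, B b c * Real.log (B b c) - C c * Real.log (C c) := by
    intro c
    have h1 : ∀ a b, P a b c * Real.log (A a c * B b c / C c) =
        P a b c * Real.log (A a c) + P a b c * Real.log (B b c) - P a b c * Real.log (C c) := by
      intro a b
      rcases (hP0 a b c).eq_or_lt with h | h
      · simp [← h]
      · have hA' : A a c ≠ 0 := (h.trans_le (hPA a b c)).ne'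
        have hB' : B b c ≠ 0 := (h.trans_le (hPB a b c)).ne'
        have hC' : C c ≠ 0 := (h.trans_le ((hPA a b c).trans (hAC a c))).ne'
        rw [Real.log_div (mul_ne_zero hA' hB') hC', Real.log_mul hA' hB']
        ring
    rw [Fintype.sum_prod_type]
    simp only [h1, Finset.sum_add_distrib, Finset.sum_sub_distrib, ← Finset.sum_mul, hAsum, hCA]
    rw [Finset.sum_comm]
    simp only [← Finset.sum_mul, hBsum]
  have total := Finset.sum_le_sum fun c (_ : c ∈ Finset.univ) => (split c).symm.le.trans (main c)
  have e1 : partitionEntropy ν (fun x => (u x, v x, w x)) =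
      -∑ c, ∑ t : α × β, P t.1 t.2 c * Real.log (P t.1 t.2 c) := by
    unfold partitionEntropy
    simp only [Real.negMulLog, neg_mul, Finset.sum_neg_distrib, Fintype.sum_prod_type]
    congr 1
    conv_rhs => rw [Finset.sum_comm]
    refine Finset.sum_congr rfl fun a _ => ?_
    rw [Finset.sum_comm]
  have e2 : partitionEntropy ν (fun x => (u x, w x)) = -∑ c, ∑ a, A a c * Real.log (A a c) := by
    unfold partitionEntropy
    simp only [Real.negMulLog, neg_mul, Finset.sum_neg_distrib, Fintype.sum_prod_type]
    rw [Finset.sum_comm]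
  have e3 : partitionEntropy ν (fun x => (v x, w x)) = -∑ c, ∑ b, B b c * Real.log (B b c) := by
    unfold partitionEntropy
    simp only [Real.negMulLog, neg_mul, Finset.sum_neg_distrib, Fintype.sum_prod_type]
    rw [Finset.sum_comm]
  have e4 : partitionEntropy ν w = -∑ c, C c * Real.log (C c) := by
    unfold partitionEntropy
    simp only [Real.negMulLog, neg_mul, Finset.sum_neg_distrib, hC]
  rw [e1, e2, e3, e4]
  rw [Finset.sum_sub_distrib, Finset.sum_add_distrib] at total
  linarith

/-- Entropy is subadditive. -/
lemma partitionEntropy_prod_le [Fintype α] [MeasurableSpace α] [MeasurableSingletonClass α]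
    [MeasurableSpace β] [MeasurableSingletonClass β] (ν : Measure X) [IsProbabilityMeasure ν]
    {u : X → α} {v : X → β} (hu : Measurable u) (hv : Measurable v) :
    partitionEntropy ν (fun x => (u x, v x)) ≤ partitionEntropy ν u + partitionEntropy ν v := by
  have h := partitionEntropy_strong_subadditive ν hu hv (measurable_const (a := ()))
  have h0 : partitionEntropy ν (fun _ : X => ()) = 0 := by simp [partitionEntropy]
  have h1 := partitionEntropy_comp_le ν (hu.prodMk (hv.prodMk (measurable_const (a := ()))))
    (fun t : α × β × Unit => (t.1, t.2.1))
  have h2 := partitionEntropy_comp_le ν hu (fun a => (a, ()))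
  have h3 := partitionEntropy_comp_le ν hv (fun a => (a, ()))
  linarith

/-- The entropy of a map with finitely many values is at most the logarithm of their number; if it
is attained then all fibres have the same mass. -/
lemma measureReal_fiber_eq_of_log_card_le [Nonempty β] [MeasurableSpace β]
    [MeasurableSingletonClass β]
    (ν : Measure X) [IsProbabilityMeasure ν] {u : X → β} (hu : Measurable u)
    (h : Real.log (Fintype.card β) ≤ partitionEntropy ν u) (b : β) :
    ν.real (u ⁻¹' {b}) = (Fintype.card β : ℝ)⁻¹ := by
  set K : ℝ := (Fintype.card β : ℝ) with hK
  have hKpos : 0 < K := by simp [hK, Fintype.card_pos]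
  by_contra hne
  have key : ∀ b, Real.negMulLog (ν.real (u ⁻¹' {b})) ≤
      ν.real (u ⁻¹' {b}) * Real.log K + (K⁻¹ - ν.real (u ⁻¹' {b})) := by
    intro b
    rcases (measureReal_nonneg (μ := ν) (s := u ⁻¹' {b})).eq_or_lt with h0 | hpos
    · simp [← h0, hKpos.le]
    · have h1 := Real.log_le_sub_one_of_pos (inv_pos.2 (mul_pos hKpos hpos))
      rw [Real.log_inv, Real.log_mul hKpos.ne' hpos.ne'] at h1
      have h2 := mul_le_mul_of_nonneg_left h1 hpos.le
      have h3 : ν.real (u ⁻¹' {b}) * ((K * ν.real (u ⁻¹' {b}))⁻¹ - 1) =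
        K⁻¹ - ν.real (u ⁻¹' {b}) := by field_simp
      rw [h3] at h2
      rw [Real.negMulLog]
      linarith
  have strict : Real.negMulLog (ν.real (u ⁻¹' {b})) <
      ν.real (u ⁻¹' {b}) * Real.log K + (K⁻¹ - ν.real (u ⁻¹' {b})) := by
    rcases (measureReal_nonneg (μ := ν) (s := u ⁻¹' {b})).eq_or_lt with h0 | hpos
    · simp [← h0, hKpos]
    · have h1 := Real.log_lt_sub_one_of_pos (inv_pos.2 (mul_pos hKpos hpos)) (by
        intro h
        apply hne
        exact eq_inv_of_mul_eq_one_right (inv_eq_one.1 h))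
      rw [Real.log_inv, Real.log_mul hKpos.ne' hpos.ne'] at h1
      have h2 := mul_lt_mul_of_pos_left h1 hpos
      have h3 : ν.real (u ⁻¹' {b}) * ((K * ν.real (u ⁻¹' {b}))⁻¹ - 1) =
        K⁻¹ - ν.real (u ⁻¹' {b}) := by field_simp
      rw [h3] at h2
      rw [Real.negMulLog]
      linarith
  have hlt : partitionEntropy ν u <
      ∑ b, (ν.real (u ⁻¹' {b}) * Real.log K + (K⁻¹ - ν.real (u ⁻¹' {b}))) :=
    Finset.sum_lt_sum (fun b _ => key b) ⟨b, Finset.mem_univ b, strict⟩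
  rw [Finset.sum_add_distrib, Finset.sum_sub_distrib, ← Finset.sum_mul,
    sum_measureReal_preimage_singleton ν hu] at hlt
  simp only [Finset.sum_const, Finset.card_univ, nsmul_eq_mul, one_mul, ← hK] at hlt
  rw [mul_inv_cancel₀ hKpos.ne'] at hlt
  linarith

lemma partitionEntropy_le_log_card [Nonempty β] [MeasurableSpace β]
    [MeasurableSingletonClass β] (ν : Measure X) [IsProbabilityMeasure ν] {u : X → β}
    (hu : Measurable u) :
    partitionEntropy ν u ≤ Real.log (Fintype.card β) := by
  by_contra! hlt
  have h := measureReal_fiber_eq_of_log_card_le ν hu hlt.le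
  simp [partitionEntropy, h, Real.negMulLog] at hlt

end Entropy

/-! ### One-sided generators -/

section Generator

variable {X : Type*}

/-- The first symbol of an itinerary is that of `x`, the others are those of `g x`. -/
lemma itinerary_eq_cases {κ : Type*} (g : X → X) (r : X → κ) {k l : ℕ} (hkl : l = k + 1) (x : X) :
    itinerary g r l x = fun i : Fin l =>
      Fin.cases (motive := fun _ => κ) (r x) (itinerary g r k (g x)) (Fin.cast hkl i) := by
  subst hkl
  funext i
  refine Fin.cases ?_ (fun j => ?_) i
  · rfl
  · simp [itinerary, Function.iterate_succ_apply]

lemma comap_itinerary_mono {ι : Type*} [MeasurableSpace ι] (g : X → X) (q : X → ι) :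
    Monotone fun n => MeasurableSpace.comap (itinerary g q n) inferInstance := by
  intro n m hnm
  have h : itinerary g q n = (fun (w : Fin m → ι) (i : Fin n) => w (Fin.castLE hnm i)) ∘
      itinerary g q m := rfl
  have hmeas : Measurable fun (w : Fin m → ι) (i : Fin n) => w (Fin.castLE hnm i) := by fun_prop
  simp only
  rw [h, ← MeasurableSpace.comap_comp]
  exact MeasurableSpace.comap_mono hmeas.comap_le

variable [mX : MeasurableSpace X]

lemma measurable_itinerary {ι : Type*} [MeasurableSpace ι] {g : X → X} {q : X → ι}
    (hg : Measurable g) (hq : Measurable q) (n : ℕ) : Measurable (itinerary g q n) :=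
  measurable_pi_lambda _ fun i => hq.comp (hg.iterate i)

/-- The fibres of `q` form a one-sided generator of `g`: the `σ`-algebra of `X` is generated by
the cylinder sets of all lengths. -/
def IsOneSidedGenerator {ι : Type*} [MeasurableSpace ι] (g : X → X) (q : X → ι) : Prop :=
  ⨆ n, MeasurableSpace.comap (itinerary g q n) inferInstance = mX

/-- Integrals of functions of a finite-valued map are finite sums. -/
lemma integral_comp_eq_sum {β : Type*} [Fintype β] [MeasurableSpace β]
    [MeasurableSingletonClass β] (ν : Measure X) [IsFiniteMeasure ν] {u : X → β}
    (hu : Measurable u) (G : β → ℝ) :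
    ∫ x, G (u x) ∂ν = ∑ b, ν.real (u ⁻¹' {b}) * G b := by
  have hG : Measurable G := measurable_of_finite G
  rw [← integral_map hu.aemeasurable hG.aestronglyMeasurable,
    integral_fintype (Integrable.of_finite)]
  refine Finset.sum_congr rfl fun b _ => ?_
  rw [map_measureReal_apply hu (measurableSet_singleton b), smul_eq_mul]

lemma setIntegral_comp_eq_sum {β : Type*} [Fintype β] [MeasurableSpace β]
    [MeasurableSingletonClass β] (ν : Measure X) [IsFiniteMeasure ν] {u : X → β}
    (hu : Measurable u) (G : β → ℝ) (T : Set β) [DecidablePred (· ∈ T)] :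
    ∫ x in u ⁻¹' T, G (u x) ∂ν = ∑ b, if b ∈ T then ν.real (u ⁻¹' {b}) * G b else 0 := by
  rw [integral_comp_eq_sum _ hu]
  refine Finset.sum_congr rfl fun b _ => ?_
  rw [measureReal_restrict_apply (hu (measurableSet_singleton b)), ← Set.preimage_inter]
  split_ifs with h
  · rw [Set.inter_eq_left.2 (by simpa using h)]
  · rw [Set.disjoint_iff_inter_eq_empty.1 (by simpa using h)]; simp

/-- Conditional probability given a finite-valued map. -/
lemma condExp_indicator_comap_ae_eq {β : Type*} [Fintype β] [mβ : MeasurableSpace β]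
    [MeasurableSingletonClass β] (ν : Measure X) [IsFiniteMeasure ν] {u : X → β}
    (hu : Measurable u) {S : Set X} (hS : MeasurableSet S) :
    (fun x => ν.real (S ∩ u ⁻¹' {u x}) / ν.real (u ⁻¹' {u x})) =ᵐ[ν]
      ν[S.indicator (fun _ => (1 : ℝ)) | MeasurableSpace.comap u mβ] := by
  classical
  set G : β → ℝ := fun b => ν.real (S ∩ u ⁻¹' {b}) / ν.real (u ⁻¹' {b}) with hG
  have hint : Integrable (fun x => G (u x)) ν := by
    have : Integrable G (ν.map u) := Integrable.of_finite
    exact this.comp_measurable hu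
  refine ae_eq_condExp_of_forall_setIntegral_eq hu.comap_le
    ((integrable_const (1 : ℝ)).indicator hS) (fun _ _ _ => hint.integrableOn) ?_ ?_
  · rintro _ ⟨T, hT, rfl⟩ _
    rw [setIntegral_comp_eq_sum ν hu G T, integral_indicator hS, setIntegral_const, smul_eq_mul,
      mul_one, measureReal_restrict_apply hS]
    have h1 : S ∩ u ⁻¹' T = ⋃ b ∈ Finset.univ.filter (· ∈ T), S ∩ u ⁻¹' {b} := by
      ext x; simp
    rw [h1, measureReal_biUnion_finset, Finset.sum_filter]
    · refine Finset.sum_congr rfl fun b _ => ?_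
      split_ifs with hb
      · rcases eq_or_ne (ν.real (u ⁻¹' {b})) 0 with h0 | h0
        · rw [h0, zero_mul]
          exact (measureReal_mono_null Set.inter_subset_right h0).symm
        · rw [hG, mul_div_cancel₀ _ h0]
      · rfl
    · intro b _ b' _ hbb'
      exact (Disjoint.preimage u (by simpa using hbb' : Disjoint {b} {b'})).mono
        Set.inter_subset_right Set.inter_subset_right
    · intro b _
      exact hS.inter (hu (measurableSet_singleton b))
  · exact ((measurable_of_finite G).comp (comap_measurable u)).aestronglyMeasurable

/-- Density theorem along the cylinders of a generator: for almost every `x` the conditional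
probability of `S` given the length-`n` cylinder of `x` tends to `1` or to `0`, according to
whether `x ∈ S`. This is Lévy's upward theorem. -/
lemma ae_tendsto_measureReal_inter_cylinder_div {ι : Type*} [Fintype ι] [MeasurableSpace ι]
    [MeasurableSingletonClass ι] (ν : Measure X) [IsFiniteMeasure ν] {g : X → X} {q : X → ι}
    (hg : Measurable g) (hq : Measurable q) (hgen : IsOneSidedGenerator g q)
    {S : Set X} (hS : MeasurableSet S) :
    ∀ᵐ x ∂ν, Tendsto (fun n => ν.real (S ∩ itinerary g q n ⁻¹' {itinerary g q n x}) /
      ν.real (itinerary g q n ⁻¹' {itinerary g q n x})) atTop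
        (𝓝 (S.indicator (fun _ => (1 : ℝ)) x)) := by
  let ℱ : Filtration ℕ mX :=
    { seq := fun n => MeasurableSpace.comap (itinerary g q n) inferInstance
      mono' := comap_itinerary_mono g q
      le' := fun n => (measurable_itinerary hg hq n).comap_le }
  have hgen' : ⨆ n, ℱ n = mX := hgen
  have h := Integrable.tendsto_ae_condExp (ℱ := ℱ)
    ((integrable_const (μ := ν) (1 : ℝ)).indicator hS) (by
      rw [hgen']
      exact (measurable_const.indicator hS).stronglyMeasurable)
  have h' : ∀ᵐ x ∂ν, ∀ n, _ := ae_all_iff.2 fun n =>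
    condExp_indicator_comap_ae_eq ν (measurable_itinerary hg hq n) hS
  filter_upwards [h, h'] with x hx hx'
  exact hx.congr fun n => (hx' n).symm

/-- Measures that agree on all cylinders of a one-sided generator agree. -/
lemma ext_of_cylinder {ι : Type*} [Fintype ι] [MeasurableSpace ι]
    [MeasurableSingletonClass ι] {μ ν : Measure X} [IsProbabilityMeasure μ]
    [IsProbabilityMeasure ν] {g : X → X} {q : X → ι} (hg : Measurable g) (hq : Measurable q)
    (hgen : IsOneSidedGenerator g q)
    (h : ∀ n (w : Fin n → ι), μ.real (itinerary g q n ⁻¹' {w}) =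
      ν.real (itinerary g q n ⁻¹' {w})) : μ = ν := by
  have hmap : ∀ n, μ.map (itinerary g q n) = ν.map (itinerary g q n) := by
    intro n
    refine Measure.ext_of_singleton fun w => ?_
    have hw := measurable_itinerary hg hq n
    rw [Measure.map_apply hw (measurableSet_singleton w),
      Measure.map_apply hw (measurableSet_singleton w)]
    exact (measureReal_eq_measureReal_iff).1 (h n w)
  refine ext_of_generate_finite (⋃ n, {s | MeasurableSet[MeasurableSpace.comap
    (itinerary g q n) inferInstance] s}) ?_ ?_ ?_ (by simp)
  · exact hgen.symm.trans (MeasurableSpace.generateFrom_iUnion_measurableSet _).symm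
  · exact isPiSystem_iUnion_of_monotone _ (fun n => @MeasurableSpace.isPiSystem_measurableSet X
      (MeasurableSpace.comap (itinerary g q n) inferInstance))
      (fun n m hnm s hs => comap_itinerary_mono g q hnm s hs)
  · intro s hs
    obtain ⟨n, T, hT, rfl⟩ := Set.mem_iUnion.1 hs
    rw [← Measure.map_apply (measurable_itinerary hg hq n) hT, hmap,
      Measure.map_apply (measurable_itinerary hg hq n) hT]

end Generator

/-! ### Measures of maximal entropy -/

section MaximalEntropy

variable {X : Type*} [MeasurableSpace X]

/-- The conditional entropy of `v` given `u`, as an integral. -/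
lemma partitionEntropy_prod_sub_eq_sum_integral {α β : Type*} [Fintype α] [MeasurableSpace α]
    [MeasurableSingletonClass α] [Fintype β] [MeasurableSpace β] [MeasurableSingletonClass β]
    (ν : Measure X) [IsProbabilityMeasure ν] {v : X → α} {u : X → β} (hv : Measurable v)
    (hu : Measurable u) :
    partitionEntropy ν (fun x => (v x, u x)) - partitionEntropy ν u =
      ∑ a, ∫ x, Real.negMulLog (ν.real (v ⁻¹' {a} ∩ u ⁻¹' {u x}) / ν.real (u ⁻¹' {u x})) ∂ν := by
  classical
  have h1 : ∀ a b, ν.real ((fun x => (v x, u x)) ⁻¹' {(a, b)}) =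
      ν.real (v ⁻¹' {a} ∩ u ⁻¹' {b}) := by
    intro a b; congr 1; ext x; simp
  have h2 : ∀ b, ∑ a, ν.real (v ⁻¹' {a} ∩ u ⁻¹' {b}) = ν.real (u ⁻¹' {b}) := by
    intro b
    rw [sum_measureReal_fiber ν (hv.prodMk hu) (fun t : α × β => t.2) b]
    simp only [← h1]
    refine Finset.sum_bij (fun a _ => (a, b)) (by simp) (by simp) ?_ (by simp)
    rintro ⟨a', b'⟩ h
    simp only [Finset.mem_filter] at h
    exact ⟨a', Finset.mem_univ _, by simp [h.2]⟩
  have h3 : ∀ a b, ν.real (u ⁻¹' {b}) *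
      Real.negMulLog (ν.real (v ⁻¹' {a} ∩ u ⁻¹' {b}) / ν.real (u ⁻¹' {b})) =
      Real.negMulLog (ν.real (v ⁻¹' {a} ∩ u ⁻¹' {b})) +
        ν.real (v ⁻¹' {a} ∩ u ⁻¹' {b}) * Real.log (ν.real (u ⁻¹' {b})) := by
    intro a b
    rcases (measureReal_nonneg (μ := ν) (s := v ⁻¹' {a} ∩ u ⁻¹' {b})).eq_or_lt with h | h
    · simp [← h]
    · have h' : 0 < ν.real (u ⁻¹' {b}) := h.trans_le (measureReal_mono Set.inter_subset_right)
      rw [Real.negMulLog, Real.negMulLog, Real.log_div h.ne' h'.ne']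
      field_simp
      ring
  have h4 : ∀ a, ∫ x, Real.negMulLog (ν.real (v ⁻¹' {a} ∩ u ⁻¹' {u x}) /
      ν.real (u ⁻¹' {u x})) ∂ν = ∑ b, (Real.negMulLog (ν.real (v ⁻¹' {a} ∩ u ⁻¹' {b})) +
        ν.real (v ⁻¹' {a} ∩ u ⁻¹' {b}) * Real.log (ν.real (u ⁻¹' {b}))) := by
    intro a
    rw [integral_comp_eq_sum ν hu fun b =>
      Real.negMulLog (ν.real (v ⁻¹' {a} ∩ u ⁻¹' {b}) / ν.real (u ⁻¹' {b}))]
    simp only [h3]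
  simp only [h4]
  rw [Finset.sum_comm]
  simp only [Finset.sum_add_distrib, ← Finset.sum_mul, h2]
  unfold partitionEntropy
  rw [Fintype.sum_prod_type, Finset.sum_comm]
  simp only [h1, Real.negMulLog, neg_mul, Finset.sum_neg_distrib]
  ring

/-- The conditional entropy of a finite partition given the cylinders of a generator tends
to `0`. -/
lemma tendsto_condEntropy_itinerary {α ι : Type*} [Fintype α] [MeasurableSpace α]
    [MeasurableSingletonClass α] [Fintype ι] [MeasurableSpace ι] [MeasurableSingletonClass ι]
    (ν : Measure X) [IsProbabilityMeasure ν] {g : X → X} {q : X → ι} {v : X → α}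
    (hg : Measurable g) (hq : Measurable q) (hgen : IsOneSidedGenerator g q)
    (hv : Measurable v) :
    Tendsto (fun m => partitionEntropy ν (fun x => (v x, itinerary g q m x)) -
      partitionEntropy ν (itinerary g q m)) atTop (𝓝 0) := by
  simp only [partitionEntropy_prod_sub_eq_sum_integral ν hv (measurable_itinerary hg hq _)]
  rw [← Finset.sum_const_zero (s := (Finset.univ : Finset α))]
  refine tendsto_finsetSum _ fun a _ => ?_
  have hS : MeasurableSet (v ⁻¹' {a}) := hv (measurableSet_singleton a)
  rw [← integral_zero X ℝ (μ := ν)]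
  refine tendsto_integral_of_dominated_convergence (fun _ => 1) ?_ (integrable_const _) ?_ ?_
  · intro m
    exact ((measurable_of_finite fun b : Fin m → ι => Real.negMulLog
      (ν.real (v ⁻¹' {a} ∩ itinerary g q m ⁻¹' {b}) / ν.real (itinerary g q m ⁻¹' {b}))).comp
        (measurable_itinerary hg hq m)).aestronglyMeasurable
  · intro m
    refine ae_of_all _ fun x => ?_
    have h0 : 0 ≤ ν.real (v ⁻¹' {a} ∩ itinerary g q m ⁻¹' {itinerary g q m x}) /
      ν.real (itinerary g q m ⁻¹' {itinerary g q m x}) := by positivity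
    have h1 : ν.real (v ⁻¹' {a} ∩ itinerary g q m ⁻¹' {itinerary g q m x}) /
      ν.real (itinerary g q m ⁻¹' {itinerary g q m x}) ≤ 1 :=
      div_le_one_of_le₀ (measureReal_mono Set.inter_subset_right) measureReal_nonneg
    rw [Real.norm_eq_abs, abs_of_nonneg (Real.negMulLog_nonneg h0 h1)]
    refine (Real.negMulLog_le_one_sub_self h0).trans (by linarith)
  · filter_upwards [ae_tendsto_measureReal_inter_cylinder_div ν hg hq hgen hS] with x hx
    have h := (Real.continuous_negMulLog.tendsto _).comp hx
    have h0 : Real.negMulLog ((v ⁻¹' {a}).indicator (fun _ => (1 : ℝ)) x) = 0 := by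
      by_cases hxa : x ∈ v ⁻¹' {a} <;> simp [hxa]
    rwa [h0] at h

/-- Comparison of the entropies of two processes: the entropy of `p` along `n` iterates exceeds
that of `q` along `n + m` iterates by at most `n` times the conditional entropy of `p` given the
`m`-cylinders of `q`. -/
lemma partitionEntropy_itinerary_le {α ι : Type*} [Fintype α] [MeasurableSpace α]
    [MeasurableSingletonClass α] [Fintype ι] [MeasurableSpace ι] [MeasurableSingletonClass ι]
    {ν : Measure X} [IsProbabilityMeasure ν] {g : X → X} {q : X → ι} {p : X → α}
    (hg : MeasurePreserving g ν ν) (hq : Measurable q) (hp : Measurable p) (m n : ℕ) :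
    partitionEntropy ν (fun x => (itinerary g p n x, itinerary g q (n + m) x)) ≤
      partitionEntropy ν (itinerary g q (n + m)) +
        n * (partitionEntropy ν (fun x => (p x, itinerary g q m x)) -
          partitionEntropy ν (itinerary g q m)) := by
  have hgm := hg.measurable
  have hQ := measurable_itinerary hgm hq
  have hP := measurable_itinerary hgm hp
  induction n with
  | zero =>
    have h := partitionEntropy_comp_le ν (hQ (0 + m))
      (fun w => ((fun i => i.elim0 : Fin 0 → α), w))
    have e : (fun x => ((fun i => i.elim0 : Fin 0 → α), itinerary g q (0 + m) x)) =
        fun x => (itinerary g p 0 x, itinerary g q (0 + m) x) := by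
      funext x; congr 1; exact Subsingleton.elim _ _
    rw [e] at h
    simpa using h
  | succ n ih =>
    -- The first symbols `p`, `q` at time `0`, and the remaining ones, pulled back along `g`.
    have hC : Measurable fun x => itinerary g q (n + m) (g x) := (hQ _).comp hgm
    have hD : Measurable fun x => itinerary g p n (g x) := (hP _).comp hgm
    have s1 := partitionEntropy_strong_subadditive ν hp hD (hq.prodMk hC)
    have s2 := partitionEntropy_strong_subadditive ν hq hD hC
    have s3 := partitionEntropy_strong_subadditive ν hp (hQ (n + 1 + m)) (hQ m)
    have i1 := partitionEntropy_comp_measurePreserving hg (hQ (n + m))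
    have i2 := partitionEntropy_comp_measurePreserving hg ((hP n).prodMk (hQ (n + m)))
    have hnm : n + 1 + m = (n + m) + 1 := by ring
    -- Reassembling the symbols is a relabelling, so it does not increase the entropy.
    have r1 : partitionEntropy ν (fun x => (itinerary g p (n + 1) x,
        itinerary g q (n + 1 + m) x)) ≤ partitionEntropy ν (fun x =>
          (p x, itinerary g p n (g x), q x, itinerary g q (n + m) (g x))) := by
      have h := partitionEntropy_comp_le ν (hp.prodMk (hD.prodMk (hq.prodMk hC)))
        (fun t => ((fun i : Fin (n + 1) => Fin.cases (motive := fun _ => α) t.1 t.2.1 i),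
          (fun i : Fin (n + 1 + m) => Fin.cases (motive := fun _ => ι) t.2.2.1 t.2.2.2
            (Fin.cast hnm i))))
      refine le_of_eq_of_le ?_ h
      congr 1
      funext x
      rw [itinerary_eq_cases g p rfl x, itinerary_eq_cases g q hnm x]
      rfl
    have r2 : partitionEntropy ν (fun x => (p x, q x, itinerary g q (n + m) (g x))) ≤
        partitionEntropy ν (fun x =>
          (p x, itinerary g q (n + 1 + m) x, itinerary g q m x)) := by
      have h := partitionEntropy_comp_le ν (hp.prodMk ((hQ (n + 1 + m)).prodMk (hQ m)))
        (fun t => (t.1, t.2.1 (Fin.cast hnm.symm 0),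
          fun i : Fin (n + m) => t.2.1 (Fin.cast hnm.symm i.succ)))
      refine le_of_eq_of_le ?_ h
      congr 1
    have r3 : partitionEntropy ν (fun x => (itinerary g q (n + 1 + m) x, itinerary g q m x)) ≤
        partitionEntropy ν (itinerary g q (n + 1 + m)) := by
      have h := partitionEntropy_comp_le ν (hQ (n + 1 + m))
        (fun t => (t, fun i : Fin m => t (Fin.castLE (by omega) i)))
      exact h
    have r4 : partitionEntropy ν (fun x => (itinerary g p n (g x), q x,
        itinerary g q (n + m) (g x))) ≤ partitionEntropy ν (fun x => (q x, itinerary g p n (g x),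
        itinerary g q (n + m) (g x))) :=
      partitionEntropy_comp_le ν (hq.prodMk (hD.prodMk hC)) (fun t => (t.2.1, t.1, t.2.2))
    push_cast
    linarith

lemma partitionEntropy_itinerary_add_le {ι : Type*} [Fintype ι] [MeasurableSpace ι]
    [MeasurableSingletonClass ι] {ν : Measure X} [IsProbabilityMeasure ν] {g : X → X} {q : X → ι}
    (hg : MeasurePreserving g ν ν) (hq : Measurable q) (m n : ℕ) :
    partitionEntropy ν (itinerary g q (m + n)) ≤
      partitionEntropy ν (itinerary g q m) + partitionEntropy ν (itinerary g q n) := by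
  have hQ := measurable_itinerary hg.measurable hq
  have hgm : MeasurePreserving g^[m] ν ν := hg.iterate m
  have h1 := partitionEntropy_prod_le ν (hQ m) ((hQ n).comp hgm.measurable)
  have h2 := partitionEntropy_comp_measurePreserving hgm (hQ n)
  have h3 := partitionEntropy_comp_le ν ((hQ m).prodMk ((hQ n).comp hgm.measurable))
    (fun t : (Fin m → ι) × (Fin n → ι) => Fin.append t.1 t.2)
  have e : (fun x => Fin.append (itinerary g q m x) ((itinerary g q n ∘ g^[m]) x)) =
      itinerary g q (m + n) := by
    funext x i
    refine Fin.addCases (fun j => ?_) (fun j => ?_) i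
    · simp [itinerary]
    · simp only [Fin.append_right, itinerary, Function.comp, Fin.val_natAdd]
      rw [← Function.iterate_add_apply, add_comm]
  simp only [e] at h3
  exact h3.trans (h1.trans (by simp only [Function.comp_def, h2, le_refl]))

lemma partitionEntropy_nonneg {β : Type*} [Fintype β] (ν : Measure X) [IsProbabilityMeasure ν]
    (u : X → β) : 0 ≤ partitionEntropy ν u :=
  Finset.sum_nonneg fun _ _ => Real.negMulLog_nonneg measureReal_nonneg measureReal_le_one

lemma partitionEntropy_itinerary_le_div {ι : Type*} [Fintype ι] [MeasurableSpace ι]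
    [MeasurableSingletonClass ι] {ν : Measure X} [IsProbabilityMeasure ν] {g : X → X} {q : X → ι}
    (hg : MeasurePreserving g ν ν) (hq : Measurable q) {k : ℕ} (hk : 0 < k) (n : ℕ) :
    partitionEntropy ν (itinerary g q n) ≤
      n * (partitionEntropy ν (itinerary g q k) / k) + partitionEntropy ν (itinerary g q k) := by
  have hmul : ∀ j : ℕ, partitionEntropy ν (itinerary g q (j * k)) ≤
      j * partitionEntropy ν (itinerary g q k) := by
    intro j
    induction j with
    | zero =>
      rw [zero_mul]
      simpa using partitionEntropy_le_log_card ν (measurable_itinerary hg.measurable hq 0)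
    | succ j ih =>
      rw [add_mul, one_mul]
      have := partitionEntropy_itinerary_add_le hg hq (j * k) k
      push_cast
      linarith
  have hlt : n < (n / k + 1) * k := by
    have := Nat.lt_div_mul_add hk (a := n)
    linarith
  have hmono := partitionEntropy_comp_le ν
    (measurable_itinerary hg.measurable hq ((n / k + 1) * k))
    (fun w => fun i : Fin n => w (Fin.castLE hlt.le i))
  have h := hmul (n / k + 1)
  have hdiv : ((n / k : ℕ) : ℝ) ≤ (n : ℝ) / k := Nat.cast_div_le
  have h0 := partitionEntropy_nonneg ν (itinerary g q k)
  have h1 := mul_le_mul_of_nonneg_right hdiv h0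
  push_cast at h
  calc _ ≤ _ := hmono
    _ ≤ _ := h
    _ ≤ _ := by
      have : (n : ℝ) / k * partitionEntropy ν (itinerary g q k) =
        n * (partitionEntropy ν (itinerary g q k) / k) := by ring
      linarith

/-- **Kolmogorov–Sinai theorem** for a one-sided generator, in the form of an upper bound: the
entropy is at most the entropy of the `k`-cylinders divided by `k`. -/
theorem metricEntropy_le_of_generator {ι : Type*} [Fintype ι] [MeasurableSpace ι]
    [MeasurableSingletonClass ι] {ν : Measure X} [IsProbabilityMeasure ν] {g : X → X} {q : X → ι}
    (hg : MeasurePreserving g ν ν) (hq : Measurable q) (hgen : IsOneSidedGenerator g q) {k : ℕ}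
    (hk : 0 < k) :
    metricEntropy g ν ≤ ((partitionEntropy ν (itinerary g q k) / k : ℝ) : EReal) := by
  refine iSup_le fun j => iSup_le fun p => iSup_le fun hp => ?_
  set h := partitionEntropy ν (itinerary g q k) / k with hh
  refine le_of_forall_gt_imp_ge_of_dense fun c hc => ?_
  induction c with
  | bot => exact absurd hc (by simp)
  | top => exact le_top
  | coe c =>
  rw [EReal.coe_lt_coe_iff] at hc
  obtain ⟨m, hm⟩ := ((tendsto_condEntropy_itinerary ν hg.measurable hq hgen hp).eventually
    (gt_mem_nhds (show (0 : ℝ) < (c - h) / 2 by linarith))).exists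
  set δ := partitionEntropy ν (fun x => (p x, itinerary g q m x)) -
    partitionEntropy ν (itinerary g q m) with hδ
  set K := m * h + partitionEntropy ν (itinerary g q k) with hK
  have hlim : Tendsto (fun n : ℕ => K / n) atTop (𝓝 0) :=
    tendsto_const_div_atTop_nhds_zero_nat K
  refine limsup_le_of_le (by isBoundedDefault) ?_
  filter_upwards [hlim.eventually (gt_mem_nhds (show (0 : ℝ) < (c - h) / 2 by linarith)),
    eventually_gt_atTop 0] with n hn hn0
  rw [EReal.coe_le_coe_iff]
  have hn0' : (0 : ℝ) < n := by exact_mod_cast hn0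
  have hP := measurable_itinerary hg.measurable hp n
  have hQ := measurable_itinerary hg.measurable hq (n + m)
  have b1 := partitionEntropy_comp_le ν (hP.prodMk hQ) Prod.fst
  have b2 := partitionEntropy_itinerary_le hg hq hp m n
  have b3 := partitionEntropy_itinerary_le_div hg hq hk (n + m)
  rw [div_lt_iff₀ hn0'] at hn
  rw [div_le_iff₀ hn0']
  have b4 := mul_lt_mul_of_pos_left hm hn0'
  push_cast at b3
  simp only at b1
  nlinarith

/-- If `q` is a one-sided generator with `k` symbols and `μ` gives mass `k⁻ⁿ` to each of the
`kⁿ` cylinders of length `n`, then `μ` is the only measure of maximal entropy. -/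
theorem isMaximalEntropyMeasure_iff_eq {k : ℕ} [NeZero k] {g : X → X} {q : X → Fin k}
    (hg : Measurable g) (hq : Measurable q) (hgen : IsOneSidedGenerator g q) {μ : Measure X}
    (hμ : IsInvariantProbability g μ)
    (hcyl : ∀ n (w : Fin n → Fin k), μ.real (itinerary g q n ⁻¹' {w}) = ((k : ℝ) ^ n)⁻¹)
    (ν : Measure X) : IsMaximalEntropyMeasure g ν ↔ ν = μ := by
  have hk : (0 : ℝ) < k := by exact_mod_cast Nat.pos_of_ne_zero (NeZero.ne k)
  have hlow : (Real.log k : EReal) ≤ metricEntropy g μ := by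
    refine le_iSup_of_le k (le_iSup_of_le q (le_iSup_of_le hq ?_))
    refine le_limsup_of_frequently_le (Eventually.frequently ?_) (by isBoundedDefault)
    filter_upwards [eventually_gt_atTop 0] with n hn
    have hn' : (0 : ℝ) < n := by exact_mod_cast hn
    rw [EReal.coe_le_coe_iff, le_div_iff₀ hn']
    simp only [partitionEntropy, hcyl, Real.negMulLog, Real.log_inv, Real.log_pow,
      Finset.sum_const, Finset.card_univ, Fintype.card_fun, Fintype.card_fin, nsmul_eq_mul]
    push_cast
    have : (k : ℝ) ^ n ≠ 0 := by positivity
    field_simp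
    linarith
  have hup : ∀ ν, IsInvariantProbability g ν → metricEntropy g ν ≤ (Real.log k : EReal) := by
    rintro ν ⟨hν, hνg⟩
    refine (metricEntropy_le_of_generator hνg hq hgen one_pos).trans ?_
    rw [EReal.coe_le_coe_iff]
    have := partitionEntropy_le_log_card ν (measurable_itinerary hg hq 1)
    simpa using this
  constructor
  · rintro ⟨hν, hmax⟩
    have := hμ.1
    have := hν.1
    refine ext_of_cylinder hg hq hgen fun n w => ?_
    rw [hcyl]
    have h := measureReal_fiber_eq_of_log_card_le ν (measurable_itinerary hg hq n) (b := w) ?_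
    · rw [h]; simp
    · rcases Nat.eq_zero_or_pos n with rfl | hn
      · simpa using partitionEntropy_nonneg ν (itinerary g q 0)
      have h1 := (hlow.trans (hmax μ hμ)).trans
        (metricEntropy_le_of_generator hν.2 hq hgen hn)
      have hn' : (0 : ℝ) < n := by exact_mod_cast hn
      rw [EReal.coe_le_coe_iff, le_div_iff₀ hn'] at h1
      simp only [Fintype.card_fun, Fintype.card_fin]
      push_cast
      rw [Real.log_pow]
      linarith
  · rintro rfl
    exact ⟨hμ, fun ν hν => (hup ν hν).trans hlow⟩

end MaximalEntropy

/-! ### Piecewise linear maps with one bend -/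

/-- The continuous function vanishing at `0` with slope `s` on `(-∞, p]` and slope `t` on
`[p, ∞)`, for `0 ≤ p`. -/
noncomputable def bend (s t p y : ℝ) : ℝ := s * min y p + t * max (y - p) 0

section Bend

variable {s t p x y : ℝ}

lemma bend_of_le (h : y ≤ p) : bend s t p y = s * y := by
  rw [bend, min_eq_left h, max_eq_right (by linarith)]; ring

lemma bend_of_ge (h : p ≤ y) : bend s t p y = s * p + t * (y - p) := by
  rw [bend, min_eq_right h, max_eq_left (by linarith)]

lemma continuous_bend : Continuous (bend s t p) := by
  unfold bend; fun_prop

lemma bend_sub_bounds {m M : ℝ} (hs : m ≤ s) (hs' : s ≤ M) (ht : m ≤ t) (ht' : t ≤ M)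
    (hxy : x ≤ y) :
    m * (y - x) ≤ bend s t p y - bend s t p x ∧ bend s t p y - bend s t p x ≤ M * (y - x) := by
  rcases le_total y p with hy | hy
  · rw [bend_of_le hy, bend_of_le (hxy.trans hy)]
    constructor <;> nlinarith
  · rcases le_total x p with hx | hx
    · rw [bend_of_ge hy, bend_of_le hx]
      constructor <;> nlinarith
    · rw [bend_of_ge hy, bend_of_ge hx]
      constructor <;> nlinarith

lemma bend_strictMono (hs : 0 < s) (ht : 0 < t) : StrictMono (bend s t p) := by
  intro x y hxy
  have h := (bend_sub_bounds (p := p) (min_le_left s t) (le_max_left s t) (min_le_right s t)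
    (le_max_right s t) hxy.le).1
  have : 0 < min s t * (y - x) := mul_pos (lt_min hs ht) (by linarith)
  linarith

/-- Inverting a bent line gives a bent line with inverse slopes. -/
lemma bend_bend_inv (hs : 0 < s) (ht : 0 < t) (x : ℝ) :
    bend s t p (bend s⁻¹ t⁻¹ (s * p) x) = x := by
  rcases le_total x (s * p) with h | h
  · rw [bend_of_le h, bend_of_le (by rw [inv_mul_le_iff₀ hs]; exact h)]
    field_simp
  · have h1 : s⁻¹ * (s * p) = p := by field_simp
    have h2 : 0 ≤ t⁻¹ * (x - s * p) := mul_nonneg (by positivity) (by linarith)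
    rw [bend_of_ge h, h1, bend_of_ge (by linarith)]
    field_simp
    ring

end Bend

/-! ### The coordinate on the circle -/

/-- The representative in `[0, 1)` of a point of the circle. -/
noncomputable def rep (x : UnitAddCircle) : ℝ := (AddCircle.equivIco (1 : ℝ) 0 x : ℝ)

lemma rep_nonneg (x : UnitAddCircle) : 0 ≤ rep x := (AddCircle.equivIco (1 : ℝ) 0 x).2.1

lemma rep_lt_one (x : UnitAddCircle) : rep x < 1 :=
  (AddCircle.equivIco (1 : ℝ) 0 x).2.2.trans_eq (zero_add 1)

@[simp] lemma coe_rep (x : UnitAddCircle) : ((rep x : ℝ) : UnitAddCircle) = x :=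
  AddCircle.coe_equivIco

lemma rep_coe_of_mem {t : ℝ} (h0 : 0 ≤ t) (h1 : t < 1) : rep (t : UnitAddCircle) = t := by
  have h : t ∈ Set.Ico (0 : ℝ) (0 + 1) := ⟨h0, by linarith⟩
  rw [rep, AddCircle.equivIco_coe_eq h]

lemma coe_add_int (t : ℝ) (k : ℤ) : ((t + k : ℝ) : UnitAddCircle) = t := by
  have h : ((k : ℝ) : UnitAddCircle) = 0 := by
    rw [AddCircle.coe_eq_zero_iff]
    exact ⟨k, by simp⟩
  rw [AddCircle.coe_add, h, add_zero]

lemma rep_coe (t : ℝ) : rep (t : UnitAddCircle) = Int.fract t := by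
  conv_lhs => rw [← Int.fract_add_floor t]
  rw [coe_add_int, rep_coe_of_mem (Int.fract_nonneg t) (Int.fract_lt_one t)]

lemma measurable_rep : Measurable rep :=
  measurable_subtype_coe.comp (AddCircle.measurableEquivIco (1 : ℝ) 0).measurable

/-! ### A circle map with two full branches -/

/-- The parameters of a degree-two circle map. Its two inverse branches have slopes `α` and
`1 - α` on `[0, p]`, and slopes `γ` and `1 - γ` on `[p, 1]`. -/
structure BranchParams where
  /-- Slope of the first inverse branch on `[0, p]`. -/
  α : ℝ
  /-- Slope of the first inverse branch on `[p, 1]`. -/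
  γ : ℝ
  /-- The point where the slopes of the inverse branches change. -/
  p : ℝ
  α_pos : 0 < α
  α_lt_one : α < 1
  γ_pos : 0 < γ
  γ_lt_one : γ < 1
  p_pos : 0 < p
  p_lt_one : p < 1

namespace BranchParams

variable (D : BranchParams)

/-- The point separating the two branches. -/
noncomputable def c : ℝ := D.α * D.p + D.γ * (1 - D.p)

lemma c_pos : 0 < D.c := by
  have h1 := mul_pos D.α_pos D.p_pos
  have h2 := mul_pos D.γ_pos (sub_pos.2 D.p_lt_one)
  unfold c; linarith

lemma c_lt_one : D.c < 1 := by
  have h1 := mul_lt_mul_of_pos_right D.α_lt_one D.p_pos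
  have h2 := mul_lt_mul_of_pos_right D.γ_lt_one (sub_pos.2 D.p_lt_one)
  unfold c; linarith

/-- Slope on `[0, p]` of the `i`-th inverse branch. -/
noncomputable def slopeLo (i : Fin 2) : ℝ := if i = 0 then D.α else 1 - D.α

/-- Slope on `[p, 1]` of the `i`-th inverse branch. -/
noncomputable def slopeHi (i : Fin 2) : ℝ := if i = 0 then D.γ else 1 - D.γ

/-- Left endpoint of the `i`-th branch. -/
noncomputable def start (i : Fin 2) : ℝ := if i = 0 then 0 else D.c

/-- The `i`-th inverse branch. -/
noncomputable def branch (i : Fin 2) (y : ℝ) : ℝ :=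
  D.start i + bend (D.slopeLo i) (D.slopeHi i) D.p y

lemma slopeLo_pos (i : Fin 2) : 0 < D.slopeLo i := by
  unfold slopeLo; split_ifs
  · exact D.α_pos
  · exact sub_pos.2 D.α_lt_one

lemma slopeHi_pos (i : Fin 2) : 0 < D.slopeHi i := by
  unfold slopeHi; split_ifs
  · exact D.γ_pos
  · exact sub_pos.2 D.γ_lt_one

lemma slopeLo_lt_one (i : Fin 2) : D.slopeLo i < 1 := by
  unfold slopeLo; split_ifs
  · exact D.α_lt_one
  · linarith [D.α_pos]

lemma slopeHi_lt_one (i : Fin 2) : D.slopeHi i < 1 := by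
  unfold slopeHi; split_ifs
  · exact D.γ_lt_one
  · linarith [D.γ_pos]

lemma branch_strictMono (i : Fin 2) : StrictMono (D.branch i) := fun _ _ h =>
  add_lt_add_right (bend_strictMono (D.slopeLo_pos i) (D.slopeHi_pos i) h) _

lemma branch_zero (i : Fin 2) : D.branch i 0 = D.start i := by
  rw [branch, bend_of_le D.p_pos.le]; ring

lemma branch_zero_one : D.branch 0 1 = D.c := by
  rw [branch, bend_of_ge D.p_lt_one.le]
  simp [start, slopeLo, slopeHi, c]

lemma branch_one_one : D.branch 1 1 = 1 := by
  rw [branch, bend_of_ge D.p_lt_one.le]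
  simp [start, slopeLo, slopeHi, c]; ring

/-- The four slopes of the map, which are inverse to those of its inverse branches, lie between
`m` and `M`. -/
def SlopeBounds (m M : ℝ) : Prop := ∀ i, m ≤ (D.slopeLo i)⁻¹ ∧ (D.slopeLo i)⁻¹ ≤ M ∧
    m ≤ (D.slopeHi i)⁻¹ ∧ (D.slopeHi i)⁻¹ ≤ M

lemma exists_slope_bounds : ∃ m M : ℝ, 1 < m ∧ D.SlopeBounds m M := by
  refine ⟨min (min (D.slopeLo 0)⁻¹ (D.slopeLo 1)⁻¹) (min (D.slopeHi 0)⁻¹ (D.slopeHi 1)⁻¹),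
    max (max (D.slopeLo 0)⁻¹ (D.slopeLo 1)⁻¹) (max (D.slopeHi 0)⁻¹ (D.slopeHi 1)⁻¹), ?_, ?_⟩
  · have h1 := fun i => (one_lt_inv₀ (D.slopeLo_pos i)).2 (D.slopeLo_lt_one i)
    have h2 := fun i => (one_lt_inv₀ (D.slopeHi_pos i)).2 (D.slopeHi_lt_one i)
    simp [h1, h2]
  · rw [SlopeBounds, Fin.forall_fin_two]
    simp

/-- The map on the fundamental domain `[0, 1]`, before reduction modulo `1`: it is inverse to the
first branch on `[0, c]`, and to the second branch, up to a shift by `1`, on `[c, 1]`. -/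
noncomputable def base (x : ℝ) : ℝ :=
  bend (D.slopeLo 0)⁻¹ (D.slopeHi 0)⁻¹ (D.slopeLo 0 * D.p) (min x D.c) +
    bend (D.slopeLo 1)⁻¹ (D.slopeHi 1)⁻¹ (D.slopeLo 1 * D.p) (max (x - D.c) 0)

lemma base_of_le_c {x : ℝ} (hx : x ≤ D.c) : D.base x =
    bend (D.slopeLo 0)⁻¹ (D.slopeHi 0)⁻¹ (D.slopeLo 0 * D.p) x := by
  have h : 0 ≤ D.slopeLo 1 * D.p := (mul_pos (D.slopeLo_pos 1) D.p_pos).le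
  rw [base, min_eq_left hx, max_eq_right (by linarith), bend_of_le h]
  simp

lemma branch_zero_base {x : ℝ} (hx : x ≤ D.c) : D.branch 0 (D.base x) = x := by
  rw [D.base_of_le_c hx, branch, bend_bend_inv (D.slopeLo_pos 0) (D.slopeHi_pos 0)]
  simp [start]

lemma base_c : D.base D.c = 1 :=
  (D.branch_strictMono 0).injective (by rw [D.branch_zero_base le_rfl, D.branch_zero_one])

lemma base_of_c_le {x : ℝ} (hx : D.c ≤ x) : D.base x =
    1 + bend (D.slopeLo 1)⁻¹ (D.slopeHi 1)⁻¹ (D.slopeLo 1 * D.p) (x - D.c) := by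
  rw [base, min_eq_right hx, max_eq_left (by linarith), ← D.base_of_le_c le_rfl, D.base_c]

lemma branch_one_base {x : ℝ} (hx : D.c ≤ x) : D.branch 1 (D.base x - 1) = x := by
  rw [D.base_of_c_le hx, branch, add_sub_cancel_left,
    bend_bend_inv (D.slopeLo_pos 1) (D.slopeHi_pos 1)]
  simp [start]

lemma base_zero : D.base 0 = 0 :=
  (D.branch_strictMono 0).injective (by
    rw [D.branch_zero_base D.c_pos.le, D.branch_zero]; simp [start])

lemma base_one : D.base 1 = 2 := by
  have h := (D.branch_strictMono 1).injective
    ((D.branch_one_base D.c_lt_one.le).trans D.branch_one_one.symm)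
  linarith

lemma continuous_base : Continuous D.base := by
  unfold base
  exact (continuous_bend.comp (by fun_prop)).add (continuous_bend.comp (by fun_prop))

variable {D}

lemma base_sub_bounds {m M : ℝ} (h : D.SlopeBounds m M) {x y : ℝ} (hxy : x ≤ y) :
    m * (y - x) ≤ D.base y - D.base x ∧ D.base y - D.base x ≤ M * (y - x) := by
  obtain ⟨a1, a2, a3, a4⟩ := h 0
  obtain ⟨b1, b2, b3, b4⟩ := h 1
  have h1 : min x D.c ≤ min y D.c := min_le_min_right _ hxy
  have h2 : max (x - D.c) 0 ≤ max (y - D.c) 0 := max_le_max_right _ (by linarith)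
  have e : ∀ z, min z D.c + max (z - D.c) 0 = z := by
    intro z
    rcases le_total z D.c with hz | hz
    · rw [min_eq_left hz, max_eq_right (by linarith)]; ring
    · rw [min_eq_right hz, max_eq_left (by linarith)]; ring
  have k1 := bend_sub_bounds (p := D.slopeLo 0 * D.p) a1 a2 a3 a4 h1
  have k2 := bend_sub_bounds (p := D.slopeLo 1 * D.p) b1 b2 b3 b4 h2
  have ex := e x
  have ey := e y
  have d1 : m * (y - x) = m * (min y D.c - min x D.c) +
      m * (max (y - D.c) 0 - max (x - D.c) 0) := by
    rw [← mul_add]; congr 1; linarith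
  have d2 : M * (y - x) = M * (min y D.c - min x D.c) +
      M * (max (y - D.c) 0 - max (x - D.c) 0) := by
    rw [← mul_add]; congr 1; linarith
  rw [d1, d2]
  unfold base
  constructor <;> linarith [k1.1, k1.2, k2.1, k2.2]

variable (D)

/-- The lift of the circle map to the line, with `F (x + 1) = F x + 2`. -/
noncomputable def lift (x : ℝ) : ℝ := 2 * ⌊x⌋ + D.base (Int.fract x)

lemma lift_eq_base {x : ℝ} (h0 : 0 ≤ x) (h1 : x ≤ 1) : D.lift x = D.base x := by
  rcases h1.eq_or_lt with rfl | h1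
  · rw [lift]
    simp [D.base_zero, D.base_one]
  · rw [lift, Int.floor_eq_zero_iff.2 ⟨h0, h1⟩, Int.fract_eq_self.2 ⟨h0, h1⟩]
    simp

lemma lift_add_one (x : ℝ) : D.lift (x + 1) = D.lift x + 2 := by
  rw [lift, lift, Int.floor_add_one, Int.fract_add_one]
  push_cast
  ring

lemma lift_eq_add (x : ℝ) : D.lift x = 2 * x + (D.base (Int.fract x) - 2 * Int.fract x) := by
  rw [lift]
  have := Int.floor_add_fract x
  linarith

lemma continuous_lift : Continuous D.lift := by
  have h : Continuous ((fun t => D.base t - 2 * t) ∘ Int.fract) :=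
    ContinuousOn.comp_fract'' (D.continuous_base.sub (by fun_prop)).continuousOn
      (by simp [D.base_zero, D.base_one])
  have e : D.lift = fun x => 2 * x + ((fun t => D.base t - 2 * t) ∘ Int.fract) x :=
    funext D.lift_eq_add
  rw [e]
  fun_prop

variable {D}

lemma lift_sub_bounds {m M : ℝ} (h : D.SlopeBounds m M) {x y : ℝ} (hxy : x ≤ y) :
    m * (y - x) ≤ D.lift y - D.lift x ∧ D.lift y - D.lift x ≤ M * (y - x) := by
  have hx := Int.floor_add_fract x
  have hy := Int.floor_add_fract y
  rcases (Int.floor_mono hxy).eq_or_lt with hf | hf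
  · have hfr : Int.fract x ≤ Int.fract y := by
      rw [hf] at hx; linarith
    have := base_sub_bounds h hfr
    have e : y - x = Int.fract y - Int.fract x := by rw [hf] at hx; linarith
    rw [lift, lift, hf, e]
    constructor <;> linarith [this.1, this.2]
  · have hf' : (1 : ℝ) ≤ ⌊y⌋ - ⌊x⌋ := by
      have : ⌊x⌋ + 1 ≤ ⌊y⌋ := hf
      have : ((⌊x⌋ + 1 : ℤ) : ℝ) ≤ (⌊y⌋ : ℝ) := by exact_mod_cast this
      push_cast at this
      linarith
    have k1 := base_sub_bounds h (Int.fract_nonneg y)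
    have k2 := base_sub_bounds h (Int.fract_lt_one x).le
    have k3 := base_sub_bounds h zero_le_one
    rw [D.base_zero] at k1 k3
    rw [D.base_one] at k2 k3
    have e : y - x = (⌊y⌋ - ⌊x⌋ - 1) + (Int.fract y - 0) + (1 - Int.fract x) := by linarith
    have e1 : ((⌊y⌋ : ℝ) - ⌊x⌋ - 1) * m ≤ (⌊y⌋ - ⌊x⌋ - 1) * 2 :=
      mul_le_mul_of_nonneg_left (by linarith [k3.1]) (by linarith)
    have e2 : ((⌊y⌋ : ℝ) - ⌊x⌋ - 1) * 2 ≤ (⌊y⌋ - ⌊x⌋ - 1) * M :=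
      mul_le_mul_of_nonneg_left (by linarith [k3.2]) (by linarith)
    rw [lift, lift, e]
    constructor
    · linarith [k1.1, k2.1]
    · linarith [k1.2, k2.2]

variable (D)

lemma lift_strictMono : StrictMono D.lift := by
  obtain ⟨m, M, hm, hb⟩ := D.exists_slope_bounds
  intro x y hxy
  have h := (lift_sub_bounds (D := D) hb hxy.le).1
  have : 0 < m * (y - x) := mul_pos (by linarith) (by linarith)
  linarith

/-- The circle map. -/
noncomputable def map (x : UnitAddCircle) : UnitAddCircle := (D.lift (rep x) : ℝ)

lemma map_coe (t : ℝ) : D.map (t : UnitAddCircle) = (D.lift t : ℝ) := by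
  rw [map, rep_coe, lift_eq_base _ (Int.fract_nonneg t) (Int.fract_lt_one t).le, lift,
    add_comm, show (2 * (⌊t⌋ : ℝ)) = ((2 * ⌊t⌋ : ℤ) : ℝ) by push_cast; ring, coe_add_int]

lemma continuous_map : Continuous D.map := by
  have h : Continuous (D.map ∘ ((↑) : ℝ → UnitAddCircle)) := by
    have e : D.map ∘ ((↑) : ℝ → UnitAddCircle) = fun t => ((D.lift t : ℝ) : UnitAddCircle) :=
      funext D.map_coe
    rw [e]
    exact (AddCircle.continuous_mk' 1).comp D.continuous_lift
  exact (QuotientAddGroup.isQuotientMap_mk _).continuous_iff.2 h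

lemma isLift_lift : IsLift D.lift D.map := ⟨D.continuous_lift, fun t => (D.map_coe t).symm⟩

lemma hasDegree_map : HasDegree D.map 2 :=
  ⟨D.lift, D.isLift_lift, fun x => by rw [D.lift_add_one]; norm_num⟩

/-- The points of `[0, 1]` where the map changes slope. -/
noncomputable def knot : Fin 5 → ℝ :=
  ![0, D.slopeLo 0 * D.p, D.c, D.c + D.slopeLo 1 * D.p, 1]

lemma knot_lt₁ : 0 < D.slopeLo 0 * D.p := mul_pos (D.slopeLo_pos 0) D.p_pos

lemma knot_lt₂ : D.slopeLo 0 * D.p < D.c := by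
  have := mul_pos D.γ_pos (sub_pos.2 D.p_lt_one)
  simp only [slopeLo, c, if_true]; linarith

lemma knot_lt₃ : D.c < D.c + D.slopeLo 1 * D.p := by
  linarith [mul_pos (D.slopeLo_pos 1) D.p_pos]

lemma knot_lt₄ : D.c + D.slopeLo 1 * D.p < 1 := by
  have := mul_pos (sub_pos.2 D.γ_lt_one) (sub_pos.2 D.p_lt_one)
  simp only [slopeLo, c, one_ne_zero, if_false]; linarith

lemma knot_strictMono : StrictMono D.knot := by
  rw [Fin.strictMono_iff_lt_succ]
  intro i
  fin_cases i
  · exact D.knot_lt₁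
  · exact D.knot_lt₂
  · exact D.knot_lt₃
  · exact D.knot_lt₄

lemma lift_piece₁ {x : ℝ} (h0 : 0 ≤ x) (h1 : x ≤ D.slopeLo 0 * D.p) :
    D.lift x = (D.slopeLo 0)⁻¹ * x := by
  have hc := D.knot_lt₂; have h := D.c_lt_one
  rw [D.lift_eq_base h0 (by linarith), D.base_of_le_c (by linarith), bend_of_le h1]

lemma lift_piece₂ {x : ℝ} (h0 : D.slopeLo 0 * D.p ≤ x) (h1 : x ≤ D.c) :
    D.lift x = (D.slopeHi 0)⁻¹ * x + (D.p - (D.slopeHi 0)⁻¹ * (D.slopeLo 0 * D.p)) := by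
  have hc := D.knot_lt₁; have h := D.c_lt_one; have h' := (D.slopeLo_pos 0).ne'
  rw [D.lift_eq_base (by linarith) (by linarith), D.base_of_le_c (by linarith),
    bend_of_ge h0, inv_mul_cancel_left₀ h']
  ring

lemma lift_piece₃ {x : ℝ} (h0 : D.c ≤ x) (h1 : x ≤ D.c + D.slopeLo 1 * D.p) :
    D.lift x = (D.slopeLo 1)⁻¹ * x + (1 - (D.slopeLo 1)⁻¹ * D.c) := by
  have hc := D.c_pos; have h := D.knot_lt₄
  rw [D.lift_eq_base (by linarith) (by linarith), D.base_of_c_le (by linarith),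
    bend_of_le (by linarith)]
  ring

lemma lift_piece₄ {x : ℝ} (h0 : D.c + D.slopeLo 1 * D.p ≤ x) (h1 : x ≤ 1) :
    D.lift x = (D.slopeHi 1)⁻¹ * x +
      (1 + D.p - (D.slopeHi 1)⁻¹ * (D.c + D.slopeLo 1 * D.p)) := by
  have hc := D.c_pos; have h := D.knot_lt₃; have h' := (D.slopeLo_pos 1).ne'
  rw [D.lift_eq_base (by linarith) (by linarith), D.base_of_c_le (by linarith),
    bend_of_ge (by linarith), inv_mul_cancel_left₀ h']
  ring

lemma isPiecewiseLinear_map : IsPiecewiseLinear D.map := by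
  refine ⟨D.lift, D.isLift_lift, 4, D.knot, D.knot_strictMono, rfl, rfl, fun i => ?_⟩
  fin_cases i
  · exact ⟨_, 0, fun x hx => by rw [add_zero]; exact D.lift_piece₁ hx.1 hx.2⟩
  · exact ⟨_, _, fun x hx => D.lift_piece₂ hx.1 hx.2⟩
  · exact ⟨_, _, fun x hx => D.lift_piece₃ hx.1 hx.2⟩
  · exact ⟨_, _, fun x hx => D.lift_piece₄ hx.1 hx.2⟩

lemma isExpandingMap_map : IsExpandingMap D.map := by
  obtain ⟨m, M, hm, hb⟩ := D.exists_slope_bounds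
  have hM : m ≤ M := (hb 0).1.trans (hb 0).2.1
  have hM0 : 0 < M := by linarith
  refine ⟨(1 + m) / 2, by linarith, 1 / (2 * M), by positivity, fun x y hxy hd => ?_⟩
  -- Lifts `s`, `s + d` of the two points with `|d|` equal to their distance.
  obtain ⟨d, hd1, hd2⟩ : ∃ d : ℝ, y = x + (d : UnitAddCircle) ∧ dist x y = |d| := by
    refine ⟨rep (y - x) - round (rep (y - x)), ?_, ?_⟩
    · have h := coe_add_int (rep (y - x)) (-round (rep (y - x)))
      push_cast at h
      rw [← sub_eq_add_neg] at h
      rw [h, coe_rep]; abel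
    · rw [dist_comm, dist_eq_norm]
      conv_lhs => rw [← coe_rep (y - x)]
      exact UnitAddCircle.norm_eq
  have hd0 : 0 < |d| := by rw [← hd2]; exact dist_pos.2 hxy
  set s := rep x with hs
  have hx : x = (s : UnitAddCircle) := (coe_rep x).symm
  have hy : y = ((s + d : ℝ) : UnitAddCircle) := by rw [hd1, AddCircle.coe_add, ← hx]
  have hdist : dist (D.map x) (D.map y) = ‖((D.lift (s + d) - D.lift s : ℝ) : UnitAddCircle)‖ := by
    rw [hx, hy, D.map_coe, D.map_coe, dist_comm, dist_eq_norm, ← AddCircle.coe_sub]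
  have bounds : m * |d| ≤ |D.lift (s + d) - D.lift s| ∧ |D.lift (s + d) - D.lift s| ≤ M * |d| := by
    rcases le_total 0 d with h | h
    · have k := lift_sub_bounds (D := D) hb (show s ≤ s + d by linarith)
      rw [add_sub_cancel_left] at k
      have : 0 ≤ m * d := mul_nonneg (by linarith) h
      rw [abs_of_nonneg h, abs_of_nonneg (by linarith [k.1])]
      exact k
    · have k := lift_sub_bounds (D := D) hb (show s + d ≤ s by linarith)
      rw [show s - (s + d) = -d by ring] at k
      have : 0 ≤ m * -d := mul_nonneg (by linarith) (by linarith)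
      rw [abs_of_nonpos h, abs_of_nonpos (by linarith [k.1]), neg_sub]
      exact k
  rw [hd2, lt_div_iff₀ (by positivity)] at hd
  have hhalf : |D.lift (s + d) - D.lift s| ≤ |(1 : ℝ)| / 2 := by
    rw [abs_one]; nlinarith [bounds.2]
  rw [hdist, (AddCircle.norm_coe_eq_abs_iff (1 : ℝ) one_ne_zero).2 hhalf, hd2]
  nlinarith [bounds.1]

end BranchParams

/-! ### Symbolic dynamics of the circle map -/

namespace BranchParams

variable (D : BranchParams)

/-- The index of the branch containing `x`. -/
noncomputable def symbol (x : UnitAddCircle) : Fin 2 := if rep x < D.c then 0 else 1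

lemma measurable_symbol : Measurable D.symbol :=
  Measurable.ite (measurableSet_lt measurable_rep measurable_const) measurable_const
    measurable_const

lemma start_nonneg (i : Fin 2) : 0 ≤ D.start i := by
  unfold start; split_ifs
  · exact le_rfl
  · exact D.c_pos.le

lemma branch_one_le (i : Fin 2) : D.branch i 1 ≤ 1 := by
  fin_cases i
  · exact D.branch_zero_one.trans_le D.c_lt_one.le
  · exact D.branch_one_one.le

lemma branch_mem {i : Fin 2} {y : ℝ} (hy : y ∈ Set.Icc (0 : ℝ) 1) :
    D.start i ≤ D.branch i y ∧ D.branch i y ≤ 1 :=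
  ⟨by rw [← D.branch_zero]; exact (D.branch_strictMono i).monotone hy.1,
    ((D.branch_strictMono i).monotone hy.2).trans (D.branch_one_le i)⟩

lemma symbol_eq_iff {x : UnitAddCircle} {i : Fin 2} :
    D.symbol x = i ↔ D.start i ≤ rep x ∧ rep x < D.branch i 1 := by
  have h0 := rep_nonneg x
  have h1 := rep_lt_one x
  fin_cases i
  · simp [symbol, start, D.branch_zero_one, h0]
  · simp [symbol, start, D.branch_one_one, h1]

/-- A point is the image of `map x` under the inverse branch given by its symbol. -/
lemma branch_rep_map (x : UnitAddCircle) : D.branch (D.symbol x) (rep (D.map x)) = rep x := by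
  have h0 := rep_nonneg x
  have h1 := rep_lt_one x
  have hmap : D.map x = (D.base (rep x) : ℝ) := by rw [map, D.lift_eq_base h0 h1.le]
  rcases lt_or_ge (rep x) D.c with h | h
  · have hb := D.branch_zero_base h.le
    have b0 : 0 ≤ D.base (rep x) := (D.branch_strictMono 0).le_iff_le.1 (by
      rw [hb, D.branch_zero]; simpa [start] using h0)
    have b1 : D.base (rep x) < 1 := (D.branch_strictMono 0).lt_iff_lt.1 (by
      rwa [hb, D.branch_zero_one])
    rw [hmap, rep_coe_of_mem b0 b1, symbol, if_pos h, hb]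
  · have hb := D.branch_one_base h
    have b0 : 0 ≤ D.base (rep x) - 1 := (D.branch_strictMono 1).le_iff_le.1 (by
      rw [hb, D.branch_zero]; simpa [start] using h)
    have b1 : D.base (rep x) - 1 < 1 := (D.branch_strictMono 1).lt_iff_lt.1 (by
      rwa [hb, D.branch_one_one])
    have e : ((D.base (rep x) : ℝ) : UnitAddCircle) =
        ((D.base (rep x) - 1 : ℝ) : UnitAddCircle) := by
      have := coe_add_int (D.base (rep x)) (-1)
      rw [← this]; congr 1; push_cast; ring
    rw [hmap, e, rep_coe_of_mem b0 b1, symbol, if_neg h.not_gt, hb]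

lemma symbol_inter_preimage_map (i : Fin 2) {y : ℝ} (hy : y ∈ Set.Icc (0 : ℝ) 1) :
    D.symbol ⁻¹' {i} ∩ D.map ⁻¹' {x | rep x < y} =
      {x | D.start i ≤ rep x ∧ rep x < D.branch i y} := by
  ext x
  simp only [Set.mem_inter_iff, Set.mem_preimage, Set.mem_singleton_iff, Set.mem_ofPred_eq]
  constructor
  · rintro ⟨rfl, hx⟩
    refine ⟨(D.symbol_eq_iff.1 rfl).1, ?_⟩
    conv_lhs => rw [← D.branch_rep_map x]
    exact D.branch_strictMono _ hx
  · rintro ⟨h0, h1⟩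
    have hs : D.symbol x = i :=
      D.symbol_eq_iff.2 ⟨h0, h1.trans_le ((D.branch_strictMono i).monotone hy.2)⟩
    refine ⟨hs, ?_⟩
    rw [← D.branch_rep_map x, hs] at h1
    exact (D.branch_strictMono i).lt_iff_lt.1 h1

lemma preimage_itinerary_succ (n : ℕ) (w : Fin (n + 1) → Fin 2) :
    itinerary D.map D.symbol (n + 1) ⁻¹' {w} =
      D.symbol ⁻¹' {w 0} ∩ D.map ⁻¹' (itinerary D.map D.symbol n ⁻¹' {Fin.tail w}) := by
  ext x
  simp only [Set.mem_inter_iff, Set.mem_preimage, Set.mem_singleton_iff,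
    itinerary_eq_cases D.map D.symbol rfl x]
  constructor
  · rintro rfl
    exact ⟨rfl, rfl⟩
  · rintro ⟨h0, h1⟩
    funext i
    refine Fin.cases ?_ (fun j => ?_) i
    · exact h0
    · exact congrFun h1 j

variable {D}

lemma SlopeBounds.slope_le {m M : ℝ} (h : D.SlopeBounds m M) (hm : 0 < m) (i : Fin 2) :
    D.slopeLo i ≤ m⁻¹ ∧ D.slopeHi i ≤ m⁻¹ :=
  ⟨le_inv_of_le_inv₀ hm (h i).1, le_inv_of_le_inv₀ hm (h i).2.2.1⟩

lemma SlopeBounds.le_slope {m M : ℝ} (h : D.SlopeBounds m M) (i : Fin 2) :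
    M⁻¹ ≤ D.slopeLo i ∧ M⁻¹ ≤ D.slopeHi i :=
  ⟨inv_le_of_inv_le₀ (D.slopeLo_pos i) (h i).2.1, inv_le_of_inv_le₀ (D.slopeHi_pos i) (h i).2.2.2⟩

/-- Points with the same itinerary are exponentially close. -/
lemma abs_rep_sub_rep_le {m M : ℝ} (h : D.SlopeBounds m M) (hm : 0 < m) (n : ℕ)
    (x y : UnitAddCircle)
    (hxy : itinerary D.map D.symbol n x = itinerary D.map D.symbol n y) :
    |rep x - rep y| ≤ m⁻¹ ^ n := by
  induction n generalizing x y with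
  | zero =>
    rw [pow_zero, abs_le]
    have := rep_nonneg x; have := rep_lt_one x; have := rep_nonneg y; have := rep_lt_one y
    constructor <;> linarith
  | succ n ih =>
    have hx : x ∈ itinerary D.map D.symbol (n + 1) ⁻¹' {itinerary D.map D.symbol (n + 1) y} := hxy
    have hy : y ∈ itinerary D.map D.symbol (n + 1) ⁻¹' {itinerary D.map D.symbol (n + 1) y} := rfl
    rw [preimage_itinerary_succ] at hx hy
    have h1 := ih (D.map x) (D.map y) (hx.2.trans hy.2.symm)
    have hs : D.symbol x = D.symbol y := hx.1.trans hy.1.symm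
    rw [← D.branch_rep_map x, ← D.branch_rep_map y, hs]
    set i := D.symbol y
    set a := rep (D.map x)
    set b := rep (D.map y)
    obtain ⟨s1, s2⟩ := h.slope_le hm i
    have p1 := D.slopeLo_pos i
    have p2 := D.slopeHi_pos i
    have key : |D.branch i a - D.branch i b| ≤ m⁻¹ * |a - b| := by
      simp only [branch, add_sub_add_left_eq_sub]
      rcases le_total a b with hab | hab
      · have k := bend_sub_bounds (p := D.p) p1.le s1 p2.le s2 hab |>.2
        have k' := (bend_strictMono (p := D.p) p1 p2).monotone hab
        rw [abs_of_nonpos (sub_nonpos.2 k'), abs_of_nonpos (sub_nonpos.2 hab)]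
        linarith
      · have k := bend_sub_bounds (p := D.p) p1.le s1 p2.le s2 hab |>.2
        have k' := (bend_strictMono (p := D.p) p1 p2).monotone hab
        rw [abs_of_nonneg (sub_nonneg.2 k'), abs_of_nonneg (sub_nonneg.2 hab)]
        linarith
    rw [pow_succ, mul_comm]
    exact key.trans (mul_le_mul_of_nonneg_left h1 (inv_nonneg.2 hm.le))

variable (D)

lemma measurable_map : Measurable D.map := D.continuous_map.measurable

/-- The partition into the two branches is a one-sided generator. -/
lemma isOneSidedGenerator_symbol : IsOneSidedGenerator D.map D.symbol := by
  obtain ⟨m, M, hm, hb⟩ := D.exists_slope_bounds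
  refine le_antisymm
    (iSup_le fun n => (measurable_itinerary D.measurable_map D.measurable_symbol n).comap_le) ?_
  have hrep : @Measurable UnitAddCircle ℝ
      (⨆ n, MeasurableSpace.comap (itinerary D.map D.symbol n) inferInstance) _ rep := by
    refine @measurable_of_Iio ℝ UnitAddCircle _ _ _
      (⨆ n, MeasurableSpace.comap (itinerary D.map D.symbol n) inferInstance) _ _ _ rep fun t => ?_
    have e : rep ⁻¹' Set.Iio t = ⋃ n, itinerary D.map D.symbol n ⁻¹'
        {w | ∀ y, itinerary D.map D.symbol n y = w → rep y < t} := by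
      ext x
      simp only [Set.mem_preimage, Set.mem_Iio, Set.mem_iUnion, Set.mem_ofPred_eq]
      constructor
      · intro hx
        obtain ⟨n, hn⟩ := exists_pow_lt_of_lt_one (sub_pos.2 hx) (inv_lt_one_of_one_lt₀ hm)
        refine ⟨n, fun y hy => ?_⟩
        have h1 := abs_rep_sub_rep_le (D := D) hb (by linarith) n y x hy
        have h2 := (abs_le.1 h1).2
        linarith
      · rintro ⟨n, hn⟩
        exact hn x rfl
    rw [e]
    refine MeasurableSet.iUnion fun n => ?_
    exact (le_iSup (fun n => MeasurableSpace.comap (itinerary D.map D.symbol n) inferInstance) n) _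
      ⟨_, Set.Finite.measurableSet (Set.toFinite _), rfl⟩
  intro S hS
  have e : S = rep ⁻¹' (((↑) : ℝ → UnitAddCircle) ⁻¹' S) := by
    ext x; simp
  rw [e]
  exact hrep (AddCircle.measurable_mk' hS)

end BranchParams

/-! ### Measures on the circle given by a distribution function -/

/-- `Φ` is the distribution function of `ν`, with respect to the coordinate `rep`. -/
def HasCdf (ν : Measure UnitAddCircle) (Φ : ℝ → ℝ) : Prop :=
  ∀ y ∈ Set.Icc (0 : ℝ) 1, ν.real {x | rep x < y} = Φ y

lemma measurableSet_rep_lt (y : ℝ) : MeasurableSet {x | rep x < y} :=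
  measurableSet_lt measurable_rep measurable_const

lemma HasCdf.measureReal_Ico {ν : Measure UnitAddCircle} [IsFiniteMeasure ν] {Φ : ℝ → ℝ}
    (h : HasCdf ν Φ) {a b : ℝ} (ha : 0 ≤ a) (hab : a ≤ b) (hb : b ≤ 1) :
    ν.real {x | a ≤ rep x ∧ rep x < b} = Φ b - Φ a := by
  rw [← h a ⟨ha, hab.trans hb⟩, ← h b ⟨ha.trans hab, hb⟩, ← measureReal_sdiff _
    (measurableSet_rep_lt a)]
  · congr 1
    ext x
    simp only [Set.mem_ofPred_eq, Set.mem_sdiff, not_lt]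
    tauto
  · exact fun x (hx : rep x < a) => hx.trans_le hab

lemma ext_of_rep_lt {μ ν : Measure UnitAddCircle} [IsFiniteMeasure μ] [IsFiniteMeasure ν]
    (h : ∀ y ∈ Set.Icc (0 : ℝ) 1, μ.real {x | rep x < y} = ν.real {x | rep x < y}) : μ = ν := by
  have h' : ∀ y, μ {x | rep x < y} = ν {x | rep x < y} := by
    intro y
    rw [← measureReal_eq_measureReal_iff]
    rcases lt_or_ge y 0 with hy | hy
    · have e : {x | rep x < y} = ∅ := by
        ext x; simpa using hy.le.trans (rep_nonneg x)
      simp [e]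
    · rcases le_or_gt y 1 with hy1 | hy1
      · exact h y ⟨hy, hy1⟩
      · have e : {x | rep x < y} = {x | rep x < 1} := by
          ext x
          simp [rep_lt_one x, (rep_lt_one x).trans hy1]
        rw [e]
        exact h 1 (by simp)
  have hmap : μ.map rep = ν.map rep := by
    refine ext_of_generate_finite (Set.range Set.Iio)
      ((BorelSpace.measurable_eq (α := ℝ)).trans (borel_eq_generateFrom_Iio ℝ)) isPiSystem_Iio ?_ ?_
    · rintro _ ⟨y, rfl⟩
      rw [Measure.map_apply measurable_rep measurableSet_Iio,
        Measure.map_apply measurable_rep measurableSet_Iio]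
      exact h' y
    · rw [Measure.map_apply measurable_rep MeasurableSet.univ,
        Measure.map_apply measurable_rep MeasurableSet.univ]
      have e : rep ⁻¹' Set.univ = {x | rep x < 1} := by
        ext x; simp [rep_lt_one x]
      rw [e]
      exact h' 1
  have hid : ∀ κ : Measure UnitAddCircle, (κ.map rep).map ((↑) : ℝ → UnitAddCircle) = κ := by
    intro κ
    rw [Measure.map_map AddCircle.measurable_mk' measurable_rep]
    have e : ((↑) : ℝ → UnitAddCircle) ∘ rep = id := funext coe_rep
    rw [e, Measure.map_id]
  rw [← hid μ, hmap, hid]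

lemma preimage_rep_lt_inter_Ico {y : ℝ} (hy1 : y ≤ 1) :
    ((↑) : ℝ → UnitAddCircle) ⁻¹' {x | rep x < y} ∩ Set.Ico 0 1 = Set.Ico 0 y := by
  ext t
  simp only [Set.mem_inter_iff, Set.mem_preimage, Set.mem_ofPred_eq, Set.mem_Ico]
  constructor
  · rintro ⟨h, h0, h1⟩
    rw [rep_coe_of_mem h0 h1] at h
    exact ⟨h0, h⟩
  · rintro ⟨h0, h⟩
    have h1 := h.trans_le hy1
    rw [rep_coe_of_mem h0 h1]
    exact ⟨h, h0, h1⟩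

lemma hasCdf_volume : HasCdf volume (fun y => y) := by
  rintro y ⟨hy0, hy1⟩
  have hmk := UnitAddCircle.measurePreserving_mk 0
  rw [← hmk.measureReal_preimage (measurableSet_rep_lt y).nullMeasurableSet,
    zero_add, Measure.restrict_congr_set (Ico_ae_eq_Ioc (a := (0 : ℝ)) (b := 1)).symm,
    measureReal_restrict_apply (AddCircle.measurable_mk' (measurableSet_rep_lt y))]
  rw [preimage_rep_lt_inter_Ico hy1]
  simp [Real.volume_real_Ico_of_le hy0]

namespace BranchParams

variable (D : BranchParams)

/-- To describe how `ν` restricted to a branch is pushed forward by the map, it is enough to look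
at distribution functions. -/
lemma measureReal_symbol_inter_preimage_map {ν ν' : Measure UnitAddCircle} [IsFiniteMeasure ν]
    [IsFiniteMeasure ν'] {Φ : ℝ → ℝ} (hΦ : HasCdf ν Φ) (i : Fin 2)
    (h : HasCdf ν' fun y => Φ (D.branch i y) - Φ (D.start i)) {S : Set UnitAddCircle}
    (hS : MeasurableSet S) :
    ν.real (D.symbol ⁻¹' {i} ∩ D.map ⁻¹' S) = ν'.real S := by
  have hq : MeasurableSet (D.symbol ⁻¹' {i}) := D.measurable_symbol (measurableSet_singleton i)
  have happ : ∀ {T}, MeasurableSet T → ((ν.restrict (D.symbol ⁻¹' {i})).map D.map).real T =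
      ν.real (D.symbol ⁻¹' {i} ∩ D.map ⁻¹' T) := by
    intro T hT
    rw [map_measureReal_apply D.measurable_map hT,
      measureReal_restrict_apply (D.measurable_map hT), Set.inter_comm]
  have e : (ν.restrict (D.symbol ⁻¹' {i})).map D.map = ν' := by
    refine ext_of_rep_lt fun y hy => ?_
    rw [happ (measurableSet_rep_lt y), D.symbol_inter_preimage_map i hy, h y hy]
    have := D.branch_mem (i := i) hy
    exact hΦ.measureReal_Ico (D.start_nonneg i) this.1 this.2
  rw [← happ hS, e]

lemma measureReal_preimage_map (ν : Measure UnitAddCircle) [IsFiniteMeasure ν]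
    (S : Set UnitAddCircle) :
    ν.real (D.map ⁻¹' S) = ν.real (D.symbol ⁻¹' {0} ∩ D.map ⁻¹' S) +
      ν.real (D.symbol ⁻¹' {1} ∩ D.map ⁻¹' S) := by
  rw [← measureReal_inter_add_sdiff (s := D.map ⁻¹' S)
    (D.measurable_symbol (measurableSet_singleton 0))]
  congr 1
  · rw [Set.inter_comm]
  · congr 1
    ext x
    simp only [Set.mem_sdiff, Set.mem_inter_iff, Set.mem_preimage, Set.mem_singleton_iff]
    have : D.symbol x = 0 ∨ D.symbol x = 1 := by
      generalize D.symbol x = i; fin_cases i <;> simp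
    rcases this with h | h <;> simp [h]

lemma measurePreserving_of_measureReal {ν : Measure UnitAddCircle} [IsFiniteMeasure ν]
    (h : ∀ S, MeasurableSet S → ν.real (D.map ⁻¹' S) = ν.real S) :
    MeasurePreserving D.map ν ν := by
  refine ⟨D.measurable_map, Measure.ext fun S hS => ?_⟩
  rw [Measure.map_apply D.measurable_map hS, ← measureReal_eq_measureReal_iff]
  exact h S hS

/-! ### Lebesgue measure: invariance and ergodicity -/

/-- The inverse branches are affine on both sides of `p`. -/
lemma volume_symbol_inter_preimage_map (i : Fin 2) {S : Set UnitAddCircle}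
    (hS : MeasurableSet S) :
    volume.real (D.symbol ⁻¹' {i} ∩ D.map ⁻¹' S) =
      D.slopeLo i * volume.real (S ∩ {x | rep x < D.p}) +
        D.slopeHi i * volume.real (S \ {x | rep x < D.p}) := by
  set ν' : Measure UnitAddCircle :=
    ENNReal.ofReal (D.slopeLo i) • volume.restrict {x | rep x < D.p} +
      ENNReal.ofReal (D.slopeHi i) • volume.restrict {x | rep x < D.p}ᶜ with hν'
  have hfin1 : IsFiniteMeasure (ENNReal.ofReal (D.slopeLo i) •
    (volume : Measure UnitAddCircle).restrict {x | rep x < D.p}) := Measure.smul_finite _ (by simp)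
  have hfin2 : IsFiniteMeasure (ENNReal.ofReal (D.slopeHi i) •
    (volume : Measure UnitAddCircle).restrict {x | rep x < D.p}ᶜ) := Measure.smul_finite _ (by simp)
  have happ : ∀ {T}, MeasurableSet T → ν'.real T =
      D.slopeLo i * volume.real (T ∩ {x | rep x < D.p}) +
        D.slopeHi i * volume.real (T \ {x | rep x < D.p}) := by
    intro T hT
    rw [hν', measureReal_add_apply, measureReal_ennreal_smul_apply,
      measureReal_ennreal_smul_apply, measureReal_restrict_apply hT, measureReal_restrict_apply hT,
      ENNReal.toReal_ofReal (D.slopeLo_pos i).le, ENNReal.toReal_ofReal (D.slopeHi_pos i).le,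
      Set.sdiff_eq]
  rw [← happ hS]
  refine D.measureReal_symbol_inter_preimage_map hasCdf_volume i (fun y hy => ?_) hS
  rw [happ (measurableSet_rep_lt y)]
  simp only [branch, add_sub_cancel_left]
  rcases le_total y D.p with h | h
  · have e1 : {x | rep x < y} ∩ {x | rep x < D.p} = {x | rep x < y} :=
      Set.inter_eq_left.2 fun x (hx : rep x < y) => hx.trans_le h
    have e2 : {x | rep x < y} \ {x | rep x < D.p} = ∅ :=
      Set.sdiff_eq_empty.2 fun x (hx : rep x < y) => hx.trans_le h
    rw [e1, e2, hasCdf_volume y hy, bend_of_le h]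
    simp
  · have e1 : {x | rep x < y} ∩ {x | rep x < D.p} = {x | rep x < D.p} :=
      Set.inter_eq_right.2 fun x (hx : rep x < D.p) => hx.trans_le h
    have e2 : {x | rep x < y} \ {x | rep x < D.p} = {x | D.p ≤ rep x ∧ rep x < y} := by
      ext x; simp [and_comm]
    rw [e1, e2, hasCdf_volume _ ⟨D.p_pos.le, D.p_lt_one.le⟩,
      hasCdf_volume.measureReal_Ico D.p_pos.le h hy.2, bend_of_ge h]

lemma measurePreserving_volume : MeasurePreserving D.map volume volume := by
  refine D.measurePreserving_of_measureReal fun S hS => ?_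
  rw [D.measureReal_preimage_map _ S, D.volume_symbol_inter_preimage_map 0 hS,
    D.volume_symbol_inter_preimage_map 1 hS,
    ← measureReal_inter_add_sdiff (s := S) (measurableSet_rep_lt D.p)]
  simp only [slopeLo, slopeHi, if_true, one_ne_zero, if_false]
  ring

/-- The Markov condition: the interval `[0, p)` is the cylinder of length `n` with all symbols
equal to `0`. -/
def IsMarkov (n : ℕ) : Prop :=
  ∀ x, rep x < D.p ↔ itinerary D.map D.symbol n x = 0

variable {D}

/-- For a Markov map, conditional probabilities of an invariant set on long cylinders are bounded
below, as a long cylinder is an affine copy of a shorter one. -/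
lemma IsMarkov.exists_volume_inter_cylinder_ge {n : ℕ} (hM : D.IsMarkov n)
    {B : Set UnitAddCircle} (hB : MeasurableSet B) (hinv : D.map ⁻¹' B = B)
    (hpos : 0 < volume.real B) : ∃ θ > 0, ∀ N, n ≤ N → ∀ w : Fin N → Fin 2,
      0 < volume.real (itinerary D.map D.symbol N ⁻¹' {w}) ∧
      θ * volume.real (itinerary D.map D.symbol N ⁻¹' {w}) ≤
        volume.real (B ∩ itinerary D.map D.symbol N ⁻¹' {w}) := by
  obtain ⟨m, M, hm, hb⟩ := D.exists_slope_bounds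
  have hM0 : 0 < M := by linarith [(hb 0).1, (hb 0).2.1]
  have hcylm : ∀ N (w : Fin N → Fin 2), MeasurableSet (itinerary D.map D.symbol N ⁻¹' {w}) :=
    fun N w => measurable_itinerary D.measurable_map D.measurable_symbol N
      (measurableSet_singleton w)
  have hsucc : ∀ N (w : Fin (N + 1) → Fin 2), B ∩ itinerary D.map D.symbol (N + 1) ⁻¹' {w} =
      D.symbol ⁻¹' {w 0} ∩ D.map ⁻¹' (B ∩ itinerary D.map D.symbol N ⁻¹' {Fin.tail w}) := by
    intro N w
    rw [D.preimage_itinerary_succ, Set.preimage_inter, hinv]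
    exact Set.inter_left_comm _ _ _
  have h1 : ∀ N (w : Fin N → Fin 2), M⁻¹ ^ N * volume.real B ≤
      volume.real (B ∩ itinerary D.map D.symbol N ⁻¹' {w}) := by
    intro N
    induction N with
    | zero =>
      intro w
      have e : itinerary D.map D.symbol 0 ⁻¹' {w} = Set.univ :=
        Set.eq_univ_of_forall fun x => Subsingleton.elim _ _
      simp [e]
    | succ N ih =>
      intro w
      have hs := SlopeBounds.le_slope (D := D) hb (w 0)
      rw [hsucc, D.volume_symbol_inter_preimage_map _ (hB.inter (hcylm _ _))]
      have h2 := ih (Fin.tail w)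
      rw [← measureReal_inter_add_sdiff (s := B ∩ itinerary D.map D.symbol N ⁻¹' {Fin.tail w})
        (measurableSet_rep_lt D.p)] at h2
      have h3 := mul_le_mul_of_nonneg_left h2 (inv_nonneg.2 hM0.le)
      rw [mul_add] at h3
      refine le_trans (le_of_eq (by ring)) (h3.trans (add_le_add ?_ ?_))
      · exact mul_le_mul_of_nonneg_right hs.1 measureReal_nonneg
      · exact mul_le_mul_of_nonneg_right hs.2 measureReal_nonneg
  refine ⟨M⁻¹ ^ n * volume.real B, by positivity, fun N hN w => ⟨?_, ?_⟩⟩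
  · have : 0 < M⁻¹ ^ N * volume.real B := by positivity
    exact this.trans_le ((h1 N w).trans (measureReal_mono Set.inter_subset_right))
  induction N, hN using Nat.le_induction with
  | base =>
    refine (mul_le_of_le_one_right (by positivity) ?_).trans (h1 n w)
    have : IsProbabilityMeasure (volume : Measure UnitAddCircle) := ⟨by simp⟩
    exact measureReal_le_one
  | succ N hN ih =>
    set S := itinerary D.map D.symbol N ⁻¹' {Fin.tail w} with hS
    have hSm : MeasurableSet S := hcylm _ _
    have hi := ih (Fin.tail w)
    rw [hsucc, D.preimage_itinerary_succ, ← hS, D.volume_symbol_inter_preimage_map _ hSm,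
      D.volume_symbol_inter_preimage_map _ (hB.inter hSm)]
    -- The first `n` symbols decide on which side of `p` a point lies.
    have hdec : ∀ x ∈ S, (rep x < D.p ↔ (fun j : Fin n => Fin.tail w (Fin.castLE hN j)) = 0) := by
      intro x hx
      rw [hM x, ← Set.mem_singleton_iff.1 (show itinerary D.map D.symbol N x ∈ _ from hx)]
      rfl
    by_cases hw : (fun j : Fin n => Fin.tail w (Fin.castLE hN j)) = 0
    · have hsub : S ⊆ {x | rep x < D.p} := fun x hx => (hdec x hx).2 hw
      have hsub' := (Set.inter_subset_right (s := B)).trans hsub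
      rw [Set.inter_eq_left.2 hsub, Set.inter_eq_left.2 hsub', Set.sdiff_eq_empty.2 hsub,
        Set.sdiff_eq_empty.2 hsub']
      have := mul_le_mul_of_nonneg_left hi (D.slopeLo_pos (w 0)).le
      simp only [measureReal_empty, mul_zero, add_zero]
      linarith
    · have hsub : Disjoint S {x | rep x < D.p} :=
        Set.disjoint_left.2 fun x hx h => hw ((hdec x hx).1 h)
      have hsub' : Disjoint (B ∩ S) {x | rep x < D.p} := hsub.mono_left Set.inter_subset_right
      rw [hsub.inter_eq, hsub'.inter_eq, hsub.sdiff_eq_left, hsub'.sdiff_eq_left]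
      have := mul_le_mul_of_nonneg_left hi (D.slopeHi_pos (w 0)).le
      simp only [measureReal_empty, mul_zero, zero_add]
      linarith

lemma IsMarkov.ergodic_volume {n : ℕ} (hM : D.IsMarkov n) : Ergodic D.map volume := by
  refine ⟨D.measurePreserving_volume, ⟨fun {B} hB hinv => ?_⟩⟩
  rw [Filter.eventuallyConst_set']
  rcases (measureReal_nonneg (μ := volume) (s := B)).eq_or_lt with h0 | hpos
  · left
    exact ae_eq_empty.2 ((measureReal_eq_zero_iff).1 h0.symm)
  · right
    obtain ⟨θ, hθ, hge⟩ := hM.exists_volume_inter_cylinder_ge hB hinv hpos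
    rw [eventuallyEq_univ]
    filter_upwards [ae_tendsto_measureReal_inter_cylinder_div volume D.measurable_map
      D.measurable_symbol D.isOneSidedGenerator_symbol hB] with x hx
    by_contra hxB
    rw [Set.indicator_of_notMem hxB] at hx
    refine hθ.not_ge (ge_of_tendsto hx ?_)
    filter_upwards [eventually_ge_atTop n] with N hN
    obtain ⟨h1, h2⟩ := hge N hN (itinerary D.map D.symbol N x)
    rwa [le_div_iff₀ h1]

lemma isACInvariantProbability_volume : IsACInvariantProbability D.map volume :=
  ⟨⟨⟨by simp⟩, D.measurePreserving_volume⟩, Measure.AbsolutelyContinuous.rfl⟩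

lemma IsMarkov.isACInvariantProbability_iff {n : ℕ} (hM : D.IsMarkov n)
    (μ : Measure UnitAddCircle) : IsACInvariantProbability D.map μ ↔ μ = volume := by
  constructor
  · rintro ⟨⟨hμ, hinv⟩, hac⟩
    have : IsProbabilityMeasure (volume : Measure UnitAddCircle) := ⟨by simp⟩
    exact hM.ergodic_volume.eq_of_absolutelyContinuous hinv hac
  · rintro rfl
    exact isACInvariantProbability_volume

end BranchParams

/-! ### The measure of maximal entropy -/

/-- A continuous distribution function is realized by a measure. -/
lemma exists_hasCdf {Φ : ℝ → ℝ} (hmono : Monotone Φ) (hcont : Continuous Φ) (h0 : Φ 0 = 0)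
    (h1 : Φ 1 = 1) : ∃ μ : Measure UnitAddCircle, IsProbabilityMeasure μ ∧ HasCdf μ Φ := by
  let f : StieltjesFunction ℝ := ⟨Φ, hmono, fun x => hcont.continuousWithinAt⟩
  have hIco : ∀ a b, f.measure (Set.Ico a b) = ENNReal.ofReal (Φ b - Φ a) := by
    intro a b
    rw [f.measure_Ico, (hcont.continuousAt.continuousWithinAt).leftLim_eq,
      (hcont.continuousAt.continuousWithinAt).leftLim_eq]
  set μ := (f.measure.restrict (Set.Ico 0 1)).map ((↑) : ℝ → UnitAddCircle) with hμ
  have happ : ∀ y ∈ Set.Icc (0 : ℝ) 1, μ {x | rep x < y} = ENNReal.ofReal (Φ y) := by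
    rintro y ⟨-, hy1⟩
    have hm : MeasurableSet {x | rep x < y} := measurableSet_rep_lt y
    rw [hμ, Measure.map_apply AddCircle.measurable_mk' hm,
      Measure.restrict_apply (AddCircle.measurable_mk' hm)]
    rw [preimage_rep_lt_inter_Ico hy1, hIco, h0, sub_zero]
  refine ⟨μ, ⟨?_⟩, fun y hy => ?_⟩
  · have e : (Set.univ : Set UnitAddCircle) = {x | rep x < 1} := by
      ext x; simp [rep_lt_one x]
    rw [e, happ 1 (by simp), h1, ENNReal.ofReal_one]
  · rw [measureReal_def, happ y hy, ENNReal.toReal_ofReal]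
    rw [← h0]
    exact hmono hy.1

namespace BranchParams

variable (D : BranchParams)

lemma abs_lift_sub_le (x : ℝ) : |D.lift x - 2 * x| ≤ 2 := by
  obtain ⟨m, M, hm, hb⟩ := D.exists_slope_bounds
  have h0 := Int.fract_nonneg x
  have h1 := (Int.fract_lt_one x).le
  have k1 := (base_sub_bounds (D := D) hb h0).1
  have k2 := (base_sub_bounds (D := D) hb h1).1
  rw [D.base_zero] at k1
  rw [D.base_one] at k2
  have k3 : 0 ≤ m * (Int.fract x - 0) := mul_nonneg (by linarith) (by linarith)
  have k4 : 0 ≤ m * (1 - Int.fract x) := mul_nonneg (by linarith) (by linarith)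
  rw [D.lift_eq_add, add_sub_cancel_left, abs_le]
  constructor <;> linarith

/-- The semiconjugacy to the doubling map: `H = lim Fⁿ / 2ⁿ`, for the lift `F`. -/
lemma exists_semiconj : ∃ H : ℝ → ℝ, Continuous H ∧ Monotone H ∧ H 0 = 0 ∧
    (∀ x, H (x + 1) = H x + 1) ∧ ∀ x, H (D.lift x) = 2 * H x := by
  set u : ℕ → ℝ → ℝ := fun n x => D.lift^[n] x / 2 ^ n with hu
  have hstep : ∀ x n, dist (u n x) (u (n + 1) x) ≤ 2 / 2 / 2 ^ n := by
    intro x n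
    have h := D.abs_lift_sub_le (D.lift^[n] x)
    rw [dist_comm, Real.dist_eq, hu]
    simp only [Function.iterate_succ_apply']
    have e : D.lift (D.lift^[n] x) / 2 ^ (n + 1) - D.lift^[n] x / 2 ^ n =
        (D.lift (D.lift^[n] x) - 2 * D.lift^[n] x) / 2 ^ (n + 1) := by
      rw [pow_succ]; field_simp
    rw [e, abs_div, abs_of_pos (by positivity : (0 : ℝ) < 2 ^ (n + 1)), pow_succ,
      div_div, mul_comm 2 (2 ^ n : ℝ)]
    gcongr
  have hlim : ∀ x, ∃ y, Tendsto (fun n => u n x) atTop (𝓝 y) := fun x =>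
    cauchySeq_tendsto_of_complete (cauchySeq_of_le_geometric_two (hstep x))
  choose H hH using hlim
  have hiter : ∀ n, Continuous (D.lift^[n]) := fun n => D.continuous_lift.iterate n
  have hshift : ∀ n x, D.lift^[n] (x + 1) = D.lift^[n] x + 2 ^ n := by
    intro n
    have hk : ∀ (k : ℕ) x, D.lift (x + k) = D.lift x + 2 * k := by
      intro k
      induction k with
      | zero => simp
      | succ k ih =>
        intro x
        push_cast
        rw [← add_assoc, D.lift_add_one, ih]; ring
    induction n with
    | zero => simp
    | succ n ih =>
      intro x
      have h := hk (2 ^ n) (D.lift^[n] x)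
      push_cast at h
      rw [Function.iterate_succ_apply', Function.iterate_succ_apply', ih, h, pow_succ]; ring
  refine ⟨H, ?_, ?_, ?_, ?_, ?_⟩
  · have hunif : TendstoUniformly u H atTop := by
      rw [Metric.tendstoUniformly_iff]
      intro ε hε
      have h2 : Tendsto (fun n : ℕ => (2 : ℝ) / 2 ^ n) atTop (𝓝 0) := by
        have := (tendsto_pow_atTop_nhds_zero_of_lt_one (r := (1 / 2 : ℝ)) (by norm_num)
          (by norm_num)).const_mul 2
        simpa [div_eq_mul_inv] using this
      filter_upwards [h2.eventually (gt_mem_nhds hε)] with n hn x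
      rw [dist_comm]
      exact (dist_le_of_le_geometric_two_of_tendsto (hstep x) (hH x) n).trans_lt hn
    exact hunif.continuous (Eventually.of_forall fun n => (hiter n).div_const _).frequently
  · intro x y hxy
    refine le_of_tendsto_of_tendsto' (hH x) (hH y) fun n => ?_
    exact div_le_div_of_nonneg_right (D.lift_strictMono.monotone.iterate n hxy) (by positivity)
  · have h0 : D.lift 0 = 0 := by rw [D.lift_eq_base le_rfl zero_le_one, D.base_zero]
    refine tendsto_nhds_unique (hH 0) ?_
    have : ∀ n, u n 0 = 0 := fun n => by
      simp only [hu, Function.iterate_fixed h0, zero_div]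
    simp only [this]
    exact tendsto_const_nhds
  · intro x
    refine tendsto_nhds_unique (hH (x + 1)) (((hH x).add_const 1).congr fun n => ?_)
    simp only [hu, hshift]
    field_simp
  · intro x
    refine tendsto_nhds_unique (hH (D.lift x))
      ((((hH x).comp (tendsto_add_atTop_nat 1)).const_mul 2).congr fun n => ?_)
    simp only [hu, Function.comp, Function.iterate_succ_apply, pow_succ]
    field_simp

lemma lift_branch_zero {y : ℝ} (hy : y ∈ Set.Icc (0 : ℝ) 1) : D.lift (D.branch 0 y) = y := by
  have h := D.branch_mem (i := 0) hy
  have hc : D.branch 0 y ≤ D.c := by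
    rw [← D.branch_zero_one]; exact (D.branch_strictMono 0).monotone hy.2
  rw [D.lift_eq_base ((D.start_nonneg 0).trans h.1) h.2]
  exact (D.branch_strictMono 0).injective (D.branch_zero_base hc)

lemma lift_branch_one {y : ℝ} (hy : y ∈ Set.Icc (0 : ℝ) 1) : D.lift (D.branch 1 y) = y + 1 := by
  have h := D.branch_mem (i := 1) hy
  rw [D.lift_eq_base ((D.start_nonneg 1).trans h.1) h.2, ← sub_eq_iff_eq_add]
  exact (D.branch_strictMono 1).injective (D.branch_one_base h.1)

/-- There is a probability measure without atoms whose two halves, on the two branches, are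
copies of the whole. -/
lemma exists_balanced_measure : ∃ (μ : Measure UnitAddCircle) (Φ : ℝ → ℝ),
    IsProbabilityMeasure μ ∧ Continuous Φ ∧ HasCdf μ Φ ∧ Φ 0 = 0 ∧ Φ 1 = 1 ∧
      ∀ i, ∀ y ∈ Set.Icc (0 : ℝ) 1, Φ (D.branch i y) = (Φ y + (i : ℕ)) / 2 := by
  obtain ⟨H, hc, hm, h0, hadd, hconj⟩ := D.exists_semiconj
  have h1 : H 1 = 1 := by have := hadd 0; rwa [zero_add, h0, zero_add] at this
  obtain ⟨μ, hμ, hcdf⟩ := exists_hasCdf hm hc h0 h1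
  refine ⟨μ, H, hμ, hc, hcdf, h0, h1, fun i y hy => ?_⟩
  have h := hconj (D.branch i y)
  fin_cases i
  · have e := D.lift_branch_zero hy
    simp only [Fin.zero_eta, Nat.cast_zero] at h ⊢
    rw [e] at h
    simp [h]
  · have e := D.lift_branch_one hy
    simp only [Fin.mk_one] at h ⊢
    rw [e, hadd] at h
    simp [h]

section Balanced

variable {D} {μ : Measure UnitAddCircle} [IsProbabilityMeasure μ] {Φ : ℝ → ℝ}
  (hcdf : HasCdf μ Φ) (h0 : Φ 0 = 0)
  (hΦ : ∀ i, ∀ y ∈ Set.Icc (0 : ℝ) 1, Φ (D.branch i y) = (Φ y + (i : ℕ)) / 2)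

include hcdf h0 hΦ

lemma measureReal_symbol_inter_preimage_of_balanced (i : Fin 2) {S : Set UnitAddCircle}
    (hS : MeasurableSet S) :
    μ.real (D.symbol ⁻¹' {i} ∩ D.map ⁻¹' S) = μ.real S / 2 := by
  have hfin : IsFiniteMeasure (ENNReal.ofReal (1 / 2) • μ) := Measure.smul_finite _ (by simp)
  have happ : ∀ T, (ENNReal.ofReal (1 / 2) • μ).real T = μ.real T / 2 := by
    intro T
    rw [measureReal_ennreal_smul_apply, ENNReal.toReal_ofReal (by norm_num)]
    ring
  rw [← happ]
  refine D.measureReal_symbol_inter_preimage_map hcdf i (fun y hy => ?_) hS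
  rw [happ, hcdf y hy]
  simp only
  rw [hΦ i y hy, ← D.branch_zero, hΦ i 0 (by simp), h0]
  ring

lemma isInvariantProbability_of_balanced : IsInvariantProbability D.map μ := by
  refine ⟨inferInstance, D.measurePreserving_of_measureReal fun S hS => ?_⟩
  rw [D.measureReal_preimage_map,
    measureReal_symbol_inter_preimage_of_balanced hcdf h0 hΦ 0 hS,
    measureReal_symbol_inter_preimage_of_balanced hcdf h0 hΦ 1 hS]
  ring

lemma measureReal_cylinder_of_balanced (n : ℕ) (w : Fin n → Fin 2) :
    μ.real (itinerary D.map D.symbol n ⁻¹' {w}) = ((2 : ℝ) ^ n)⁻¹ := by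
  induction n with
  | zero =>
    have e : itinerary D.map D.symbol 0 ⁻¹' {w} = Set.univ :=
      Set.eq_univ_of_forall fun x => Subsingleton.elim _ _
    simp [e]
  | succ n ih =>
    rw [D.preimage_itinerary_succ, measureReal_symbol_inter_preimage_of_balanced hcdf h0 hΦ _
      (measurable_itinerary D.measurable_map D.measurable_symbol n (measurableSet_singleton _)),
      ih, pow_succ]
    field_simp

lemma isMaximalEntropyMeasure_iff_of_balanced (ν : Measure UnitAddCircle) :
    IsMaximalEntropyMeasure D.map ν ↔ ν = μ :=
  isMaximalEntropyMeasure_iff_eq D.measurable_map D.measurable_symbol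
    D.isOneSidedGenerator_symbol (isInvariantProbability_of_balanced hcdf h0 hΦ)
    (fun n w => by
      rw [measureReal_cylinder_of_balanced hcdf h0 hΦ]; norm_num) ν

lemma IsMarkov.cdf_p_of_balanced {n : ℕ} (hM : D.IsMarkov n) : Φ D.p = ((2 : ℝ) ^ n)⁻¹ := by
  rw [← hcdf D.p ⟨D.p_pos.le, D.p_lt_one.le⟩,
    ← measureReal_cylinder_of_balanced hcdf h0 hΦ n (0 : Fin n → Fin 2)]
  congr 1
  ext x
  exact hM x

end Balanced

end BranchParams

/-! ### Lyapunov exponents -/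

/-- The displacement of a circle map has the derivative of a lift. -/
lemma hasDerivAt_displacement {F : ℝ → ℝ} {g : UnitAddCircle → UnitAddCircle} (hF : IsLift F g)
    {t s : ℝ} (h : HasDerivAt F s t) : HasDerivAt (displacement g (t : UnitAddCircle)) s 0 := by
  have h1 : HasDerivAt (fun d => F (t + d) - F t) s 0 := by
    have h' : HasDerivAt F s (t + 0) := by rwa [add_zero]
    exact (h'.comp_const_add t 0).sub_const (F t)
  refine h1.congr_of_eventuallyEq ?_
  have hc : ContinuousAt (fun d => F (t + d) - F t) 0 := h1.continuousAt
  have hmem : ∀ᶠ d in 𝓝 (0 : ℝ), F (t + d) - F t ∈ Set.Ioo (-1 / 2 : ℝ) (1 / 2) :=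
    hc.eventually_mem (Ioo_mem_nhds (by simp; norm_num) (by simp))
  filter_upwards [hmem] with d hd
  have e : g ((t : UnitAddCircle) + (d : UnitAddCircle)) - g (t : UnitAddCircle) =
      ((F (t + d) - F t : ℝ) : UnitAddCircle) := by
    rw [AddCircle.coe_sub, hF.2, hF.2, AddCircle.coe_add]
  have hd' : F (t + d) - F t ∈ Set.Ioc (-1 / 2 : ℝ) (-1 / 2 + 1) :=
    ⟨hd.1, by linarith [hd.2]⟩
  rw [displacement, e, AddCircle.equivIoc_coe_eq hd']

lemma hasDerivAt_of_affine {F : ℝ → ℝ} {a b s d t : ℝ} (hat : a < t) (htb : t < b)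
    (h : ∀ x, a ≤ x → x ≤ b → F x = s * x + d) : HasDerivAt F s t := by
  have h1 : HasDerivAt (fun x => s * x + d) s t := by
    simpa using ((hasDerivAt_id t).const_mul s).add_const d
  refine h1.congr_of_eventuallyEq ?_
  filter_upwards [Ioo_mem_nhds hat htb] with x hx
  exact h x hx.1.le hx.2.le

/-- A measure with continuous distribution function has no atoms. -/
lemma HasCdf.measure_rep_eq {ν : Measure UnitAddCircle} [IsFiniteMeasure ν] {Φ : ℝ → ℝ}
    (h : HasCdf ν Φ) (hΦ : Continuous Φ) {t : ℝ} (h0 : 0 ≤ t) (h1 : t < 1) :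
    ν {x | rep x = t} = 0 := by
  rw [← measureReal_eq_zero_iff]
  refine le_antisymm ?_ measureReal_nonneg
  have hlim : Tendsto (fun y => Φ y - Φ t) (𝓝[>] t) (𝓝 0) := by
    have := (hΦ.tendsto t).sub_const (Φ t)
    rw [sub_self] at this
    exact this.mono_left nhdsWithin_le_nhds
  refine ge_of_tendsto hlim ?_
  filter_upwards [Ioo_mem_nhdsGT h1] with y hy
  rw [← h.measureReal_Ico h0 hy.1.le hy.2.le]
  exact measureReal_mono fun x (hx : rep x = t) => ⟨hx.ge, hx.trans_lt hy.1⟩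

namespace BranchParams

variable (D : BranchParams)

/-- The linearity domain containing `x`: the branch, and the side of `p` on which the image
lies. -/
noncomputable def piece (x : UnitAddCircle) : Fin 2 × Fin 2 :=
  (D.symbol x, if rep (D.map x) < D.p then 0 else 1)

/-- The slope of an inverse branch on the domain with the given index. -/
noncomputable def pieceSlope (b : Fin 2 × Fin 2) : ℝ :=
  if b.2 = 0 then D.slopeLo b.1 else D.slopeHi b.1

lemma measurable_piece : Measurable D.piece :=
  D.measurable_symbol.prodMk (Measurable.ite
    (measurableSet_lt (measurable_rep.comp D.measurable_map) measurable_const) measurable_const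
    measurable_const)

lemma pieceSlope_pos (b : Fin 2 × Fin 2) : 0 < D.pieceSlope b := by
  unfold pieceSlope; split_ifs
  · exact D.slopeLo_pos _
  · exact D.slopeHi_pos _

lemma rep_map_lt_iff (x : UnitAddCircle) :
    rep (D.map x) < D.p ↔ rep x < D.branch (D.symbol x) D.p := by
  conv_rhs => rw [← D.branch_rep_map x]
  exact (D.branch_strictMono _).lt_iff_lt.symm

lemma branch_p (i : Fin 2) : D.branch i D.p = D.start i + D.slopeLo i * D.p := by
  rw [branch, bend_of_le le_rfl]

/-- Away from the points of non-differentiability the derivative is the inverse of the slope of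
the inverse branch. -/
lemma hasDerivAt_displacement_map {x : UnitAddCircle}
    (h : ∀ i, rep x ≠ D.start i ∧ rep x ≠ D.branch i D.p) :
    HasDerivAt (displacement D.map x) (D.pieceSlope (D.piece x))⁻¹ 0 := by
  have k : HasDerivAt D.lift (D.pieceSlope (D.piece x))⁻¹ (rep x) := by
    have hi := D.symbol_eq_iff (x := x).1 rfl
    obtain ⟨n1, n2⟩ := h (D.symbol x)
    have hl := lt_of_le_of_ne hi.1 n1.symm
    have hp := D.rep_map_lt_iff x
    have hsym : D.symbol x = 0 ∨ D.symbol x = 1 := by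
      generalize D.symbol x = i; fin_cases i <;> simp
    simp only [piece, pieceSlope, hp, D.branch_p] at n2 ⊢
    rcases hsym with hs | hs <;> rw [hs] at hi hl n2 ⊢ <;>
      simp only [start, if_true, one_ne_zero, if_false, zero_add, D.branch_zero_one,
        D.branch_one_one] at hi hl n2 ⊢
    · rcases lt_or_gt_of_ne n2 with h2 | h2
      · simp only [h2, if_true]
        exact hasDerivAt_of_affine hl h2 (d := 0) fun x h0 h1 => by
          rw [add_zero]; exact D.lift_piece₁ h0 h1
      · simp only [h2.not_gt, if_false, one_ne_zero]
        exact hasDerivAt_of_affine h2 hi.2 fun x h0 h1 => D.lift_piece₂ h0 h1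
    · rcases lt_or_gt_of_ne n2 with h2 | h2
      · simp only [h2, if_true]
        exact hasDerivAt_of_affine hl h2 fun x h0 h1 => D.lift_piece₃ h0 h1
      · simp only [h2.not_gt, if_false, one_ne_zero]
        exact hasDerivAt_of_affine h2 hi.2 fun x h0 h1 => D.lift_piece₄ h0 h1
  have := hasDerivAt_displacement D.isLift_lift k
  rwa [coe_rep] at this

/-- The Lyapunov exponent with respect to a measure with continuous distribution function. -/
lemma hasLyapunovExponent_map {ν : Measure UnitAddCircle} [IsFiniteMeasure ν] {Φ : ℝ → ℝ}
    (h : HasCdf ν Φ) (hΦ : Continuous Φ) :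
    HasLyapunovExponent D.map ν (∑ i,
      (-(Real.log (D.slopeLo i) * (Φ (D.branch i D.p) - Φ (D.start i))) -
        Real.log (D.slopeHi i) * (Φ (D.branch i 1) - Φ (D.branch i D.p)))) := by
  have hp : D.p ∈ Set.Icc (0 : ℝ) 1 := ⟨D.p_pos.le, D.p_lt_one.le⟩
  have hlt : ∀ i, D.branch i D.p < 1 := fun i =>
    (D.branch_strictMono i D.p_lt_one).trans_le (D.branch_one_le i)
  have hge : ∀ i, 0 ≤ D.branch i D.p := fun i => (D.start_nonneg i).trans (D.branch_mem hp).1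
  have hst : ∀ i, D.start i < 1 := fun i => (D.branch_mem hp).1.trans_lt (hlt i)
  have hae : ∀ᵐ x ∂ν, ∀ i, rep x ≠ D.start i ∧ rep x ≠ D.branch i D.p := by
    rw [ae_all_iff]
    intro i
    have h1 : ∀ᵐ x ∂ν, rep x ≠ D.start i := by
      rw [ae_iff]
      simpa using h.measure_rep_eq hΦ (D.start_nonneg i) (hst i)
    have h2 : ∀ᵐ x ∂ν, rep x ≠ D.branch i D.p := by
      rw [ae_iff]
      simpa using h.measure_rep_eq hΦ (hge i) (hlt i)
    filter_upwards [h1, h2] with x hx1 hx2 using ⟨hx1, hx2⟩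
  set G : Fin 2 × Fin 2 → ℝ := fun b => -Real.log (D.pieceSlope b) with hG
  have hlog : (fun x => G (D.piece x)) =ᵐ[ν] fun x => Real.log |circleDeriv D.map x| := by
    filter_upwards [hae] with x hx
    rw [circleDeriv, (D.hasDerivAt_displacement_map hx).deriv,
      abs_of_pos (inv_pos.2 (D.pieceSlope_pos _)), Real.log_inv]
  have hint : Integrable (fun x => G (D.piece x)) ν :=
    (Integrable.of_finite : Integrable G (ν.map D.piece)).comp_measurable D.measurable_piece
  refine ⟨?_, hint.congr hlog, ?_⟩
  · filter_upwards [hae] with x hx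
    exact (D.hasDerivAt_displacement_map hx).differentiableAt
  · rw [← integral_congr_ae hlog, integral_comp_eq_sum ν D.measurable_piece,
      Fintype.sum_prod_type]
    refine Finset.sum_congr rfl fun i _ => ?_
    have hLo : ν.real (D.piece ⁻¹' {(i, 0)}) = Φ (D.branch i D.p) - Φ (D.start i) := by
      rw [← h.measureReal_Ico (D.start_nonneg i) (D.branch_mem hp).1 (hlt i).le,
        ← D.symbol_inter_preimage_map i hp]
      congr 1
      ext x
      simp [piece]
    have hHi : ν.real (D.piece ⁻¹' {(i, 1)}) = Φ (D.branch i 1) - Φ (D.branch i D.p) := by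
      rw [← h.measureReal_Ico (hge i) (D.branch_strictMono i D.p_lt_one).le (D.branch_one_le i)]
      congr 1
      ext x
      simp only [Set.mem_preimage, piece, Set.mem_singleton_iff, Prod.mk.injEq, D.rep_map_lt_iff,
        Set.mem_ofPred_eq]
      constructor
      · rintro ⟨rfl, h2⟩
        exact ⟨not_lt.1 fun h => by simp [h] at h2, (D.symbol_eq_iff.1 rfl).2⟩
      · rintro ⟨h1, h2⟩
        have hs : D.symbol x = i := D.symbol_eq_iff.2 ⟨(D.branch_mem hp).1.trans h1, h2⟩
        refine ⟨hs, ?_⟩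
        rw [hs, if_neg h1.not_gt]
    rw [Fin.sum_univ_two, hLo, hHi]
    simp only [hG, pieceSlope, if_true, one_ne_zero, if_false]
    ring

/-- `λ_abs` is an average of two binary entropies. -/
lemma IsMarkov.hasLambdaAbs {D : BranchParams} {n : ℕ} (hM : D.IsMarkov n) :
    HasLambdaAbs D.map (D.p * Real.binEntropy D.α + (1 - D.p) * Real.binEntropy D.γ) := by
  refine ⟨⟨volume, isACInvariantProbability_volume,
    fun μ hμ => (hM.isACInvariantProbability_iff μ).1 hμ⟩, fun μ hμ => ?_⟩
  rw [(hM.isACInvariantProbability_iff μ).1 hμ]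
  convert! D.hasLyapunovExponent_map hasCdf_volume continuous_id' using 1
  rw [Fin.sum_univ_two, D.branch_p, D.branch_p, D.branch_zero_one, D.branch_one_one,
    Real.binEntropy_eq_negMulLog_add_negMulLog_one_sub,
    Real.binEntropy_eq_negMulLog_add_negMulLog_one_sub]
  simp only [Real.negMulLog, start, slopeLo, slopeHi, c, if_true, one_ne_zero, if_false]
  ring

/-- The measure of maximal entropy gives mass `2⁻ⁿ` to `[0, p)`, and each inverse branch carries
half of it. -/
lemma IsMarkov.hasLambdaMax {D : BranchParams} {n : ℕ} (hM : D.IsMarkov n) :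
    HasLambdaMax D.map (-(((2 : ℝ) ^ n)⁻¹ * Real.log (D.α * (1 - D.α)) +
      (1 - ((2 : ℝ) ^ n)⁻¹) * Real.log (D.γ * (1 - D.γ))) / 2) := by
  obtain ⟨μ, Φ, hμ, hΦc, hcdf, h0, h1, hΦ⟩ := D.exists_balanced_measure
  have hiff := isMaximalEntropyMeasure_iff_of_balanced hcdf h0 hΦ
  refine ⟨⟨μ, (hiff μ).2 rfl, fun ν hν => (hiff ν).1 hν⟩, fun ν hν => ?_⟩
  rw [(hiff ν).1 hν]
  convert! D.hasLyapunovExponent_map hcdf hΦc using 1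
  have hp := hM.cdf_p_of_balanced hcdf h0 hΦ
  rw [Fin.sum_univ_two, ← D.branch_zero, ← D.branch_zero, hΦ 0 0 (by simp), hΦ 1 0 (by simp),
    hΦ 0 1 (by simp), hΦ 1 1 (by simp), hΦ 0 D.p ⟨D.p_pos.le, D.p_lt_one.le⟩,
    hΦ 1 D.p ⟨D.p_pos.le, D.p_lt_one.le⟩, h0, h1, hp,
    Real.log_mul D.α_pos.ne' (sub_pos.2 D.α_lt_one).ne',
    Real.log_mul D.γ_pos.ne' (sub_pos.2 D.γ_lt_one).ne']
  simp only [slopeLo, slopeHi, if_true, one_ne_zero, if_false]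
  ring

end BranchParams

/-! ### Choice of the parameters -/

/-- The Lebesgue measure of the cylinder `0ⁿ`, when the inverse branches have slopes `α`, `1 - α`
on this cylinder and `γ`, `1 - γ` elsewhere. -/
noncomputable def markovPoint (n : ℕ) (α γ : ℝ) : ℝ :=
  γ ^ n * (1 - γ) / ((1 - α) + γ ^ n * (α - γ))

section MarkovPoint

variable {n : ℕ} {α γ : ℝ}

lemma markovPoint_denom_pos (hα1 : α < 1) (hγ0 : 0 < γ) (hγ1 : γ < 1) :
    0 < (1 - α) + γ ^ n * (α - γ) := by
  have h1 : γ ^ n ≤ 1 := pow_le_one₀ hγ0.le hγ1.le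
  have h2 : 0 < γ ^ n := pow_pos hγ0 n
  have h3 : 0 < γ ^ n * (1 - γ) := mul_pos h2 (by linarith)
  have h4 : 0 ≤ (1 - α) * (1 - γ ^ n) := mul_nonneg (by linarith) (by linarith)
  nlinarith

lemma markovPoint_pos (hα1 : α < 1) (hγ0 : 0 < γ) (hγ1 : γ < 1) : 0 < markovPoint n α γ :=
  div_pos (mul_pos (pow_pos hγ0 n) (by linarith)) (markovPoint_denom_pos hα1 hγ0 hγ1)

lemma markovPoint_lt_one (hn : n ≠ 0) (hα1 : α < 1) (hγ0 : 0 < γ) (hγ1 : γ < 1) :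
    markovPoint n α γ < 1 := by
  rw [markovPoint, div_lt_one (markovPoint_denom_pos hα1 hγ0 hγ1)]
  have h1 : γ ^ n < 1 := pow_lt_one₀ hγ0.le hγ1 hn
  have h4 : 0 < (1 - α) * (1 - γ ^ n) := mul_pos (by linarith) (by linarith)
  nlinarith

end MarkovPoint

namespace BranchParams

/-- The Markov condition holds when `p` is the `n`-th image of `1` under the first inverse
branch. The points `z k` are these images: they approach geometrically the fixed point `e` of the
affine continuation of the branch from `[p, 1]`. -/
lemma isMarkov_of_eq (D : BranchParams) {n : ℕ} (h : D.p = markovPoint n D.α D.γ) :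
    D.IsMarkov n := by
  have hγ : 0 < 1 - D.γ := sub_pos.2 D.γ_lt_one
  have hα : 0 < 1 - D.α := sub_pos.2 D.α_lt_one
  rw [markovPoint, eq_div_iff (markovPoint_denom_pos D.α_lt_one D.γ_pos D.γ_lt_one).ne'] at h
  obtain ⟨e, he⟩ : ∃ e, (1 - D.γ) * e = (D.α - D.γ) * D.p :=
    ⟨(D.α - D.γ) * D.p / (1 - D.γ), by field_simp⟩
  have he1 : 0 < 1 - e := by
    have h1 : 0 < (1 - D.γ) * (1 - D.p) + D.p * (1 - D.α) :=
      add_pos (mul_pos hγ (sub_pos.2 D.p_lt_one)) (mul_pos D.p_pos hα)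
    have h2 : 0 < (1 - D.γ) * (1 - e) := by rw [mul_sub, he]; linarith
    exact pos_of_mul_pos_right h2 hγ.le
  set z : ℕ → ℝ := fun k => e + D.γ ^ k * (1 - e) with hz
  have hzn : z n = D.p := by
    have h3 : (1 - D.γ) * z n = (1 - D.γ) * D.p := by
      simp only [hz]
      linear_combination (1 - D.γ ^ n) * he - h
    exact mul_left_cancel₀ hγ.ne' h3
  have hzp : ∀ k ≤ n, D.p ≤ z k := by
    intro k hk
    rw [← hzn]
    have := pow_le_pow_of_le_one D.γ_pos.le D.γ_lt_one.le hk
    have := mul_le_mul_of_nonneg_right this he1.le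
    simp only [hz]; linarith
  have hz1 : ∀ k, z k ≤ 1 := by
    intro k
    have := mul_le_mul_of_nonneg_right (pow_le_one₀ D.γ_pos.le D.γ_lt_one.le (n := k)) he1.le
    simp only [hz]; linarith
  have hstep : ∀ k ≤ n, D.branch 0 (z k) = z (k + 1) := by
    intro k hk
    rw [branch, bend_of_ge (hzp k hk)]
    simp only [start, slopeLo, slopeHi, if_true, hz, pow_succ]
    linear_combination -he
  have main : ∀ k ≤ n, ∀ x, rep x < z k ↔ itinerary D.map D.symbol k x = 0 := by
    intro k
    induction k with
    | zero =>
      intro _ x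
      simp only [hz, pow_zero, one_mul, add_sub_cancel, rep_lt_one x, true_iff]
      exact Subsingleton.elim _ _
    | succ k ih =>
      intro hk x
      have hk' : k ≤ n := by omega
      have h1 := Set.ext_iff.1 (D.preimage_itinerary_succ k 0) x
      have h2 := Set.ext_iff.1 (D.symbol_inter_preimage_map 0
        (y := z k) ⟨D.p_pos.le.trans (hzp k hk'), hz1 k⟩) x
      rw [hstep k hk'] at h2
      simp only [Set.mem_inter_iff, Set.mem_preimage, Set.mem_singleton_iff,
        Set.mem_ofPred_eq] at h1 h2
      have h3 : Fin.tail (0 : Fin (k + 1) → Fin 2) = 0 := rfl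
      rw [h1, h3, ← ih hk' (D.map x), Pi.zero_apply, h2]
      simp [start, rep_nonneg x]
  intro x
  rw [← hzn]
  exact main n le_rfl x

end BranchParams

/-- The value of `λ_abs` as a function of the slopes. -/
noncomputable def markovEntropy (n : ℕ) (α γ : ℝ) : ℝ :=
  markovPoint n α γ * Real.binEntropy α + (1 - markovPoint n α γ) * Real.binEntropy γ

/-- At the end `α = δ` the cylinder `0ⁿ` has Lebesgue measure at most `2 · 2⁻ⁿ`. -/
lemma markovEntropy_half_ge {n : ℕ} (hn : n ≠ 0) {δ : ℝ} (hδ0 : 0 < δ) (hδ : δ < 1 / 2) :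
    (1 - 2 * (1 / 2 : ℝ) ^ n) * Real.log 2 ≤ markovEntropy n δ (1 / 2) := by
  have hpos := markovPoint_pos (n := n) (α := δ) (γ := 1 / 2) (by linarith) (by norm_num)
    (by norm_num)
  have hlog := Real.log_pos (one_lt_two (α := ℝ))
  have hpow : (1 / 2 : ℝ) ^ n ≤ 1 / 2 :=
    pow_le_of_le_one (by norm_num) (by norm_num) hn
  have hpow0 : (0 : ℝ) < (1 / 2) ^ n := by positivity
  have hle : markovPoint n δ (1 / 2) ≤ 2 * (1 / 2 : ℝ) ^ n := by
    rw [markovPoint, div_le_iff₀ (markovPoint_denom_pos (by linarith) (by norm_num) (by norm_num))]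
    have h1 : (1 / 4 : ℝ) ≤ 1 - δ + (1 / 2) ^ n * (δ - 1 / 2) := by nlinarith
    have h2 := mul_le_mul_of_nonneg_left h1 hpow0.le
    linarith
  have h0 := mul_nonneg hpos.le (Real.binEntropy_nonneg hδ0.le (by linarith : δ ≤ 1))
  have h1 := mul_le_mul_of_nonneg_right hle hlog.le
  have h2 : Real.binEntropy (1 / 2) = Real.log 2 := by
    rw [one_div]; exact Real.binEntropy_two_inv
  rw [markovEntropy, h2]
  linarith

/-- At the end `α = 1 - δ` the complement of the cylinder `0ⁿ` has Lebesgue measure at most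
`2 · 2ⁿ δ`. -/
lemma markovEntropy_half_le {n : ℕ} (hn : n ≠ 0) {δ : ℝ} (hδ0 : 0 < δ) (hδ : δ < 1 / 2) :
    markovEntropy n (1 - δ) (1 / 2) ≤ Real.binEntropy δ + 2 * 2 ^ n * δ * Real.log 2 := by
  have hlog := Real.log_pos (one_lt_two (α := ℝ))
  have hlt := markovPoint_lt_one (α := 1 - δ) (γ := 1 / 2) hn (by linarith) (by norm_num)
    (by norm_num)
  have hpow0 : (0 : ℝ) < (1 / 2) ^ n := by positivity
  have hpow1 : (1 / 2 : ℝ) ^ n ≤ 1 := pow_le_one₀ (by norm_num) (by norm_num)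
  have hden := markovPoint_denom_pos (n := n) (α := 1 - δ) (γ := 1 / 2) (by linarith)
    (by norm_num) (by norm_num)
  have hinv : (2 : ℝ) ^ n * (1 / 2) ^ n = 1 := by rw [← mul_pow]; norm_num
  have hle : 1 - markovPoint n (1 - δ) (1 / 2) ≤ 2 * 2 ^ n * δ := by
    have e : 1 - markovPoint n (1 - δ) (1 / 2) =
        (δ * (1 - (1 / 2) ^ n)) / ((1 - (1 - δ)) + (1 / 2) ^ n * ((1 - δ) - 1 / 2)) := by
      rw [markovPoint, eq_div_iff hden.ne', sub_mul, div_mul_cancel₀ _ hden.ne']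
      ring
    rw [e, div_le_iff₀ hden]
    have h1 : (1 / 2 : ℝ) ^ n / 2 ≤ (1 - (1 - δ)) + (1 / 2) ^ n * ((1 - δ) - 1 / 2) := by
      nlinarith
    have h2 := mul_le_mul_of_nonneg_left h1 (by positivity : (0 : ℝ) ≤ 2 * 2 ^ n * δ)
    have h3 : 2 * 2 ^ n * δ * ((1 / 2 : ℝ) ^ n / 2) = δ := by linear_combination δ * hinv
    nlinarith
  have h0 := Real.binEntropy_nonneg hδ0.le (by linarith : δ ≤ 1)
  have h1 := mul_le_mul_of_nonneg_right hle hlog.le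
  have h3 := mul_le_mul_of_nonneg_right hlt.le h0
  have h2 : Real.binEntropy (1 / 2) = Real.log 2 := by
    rw [one_div]; exact Real.binEntropy_two_inv
  rw [markovEntropy, h2, Real.binEntropy_one_sub]
  linarith

/-- For fixed `n`, the slopes with `λ_max = b` contain a curve along which `λ_abs` takes all
values between those at its endpoints, where `γ = 1/2` and `α` is `δ` or `1 - δ`. -/
lemma exists_slopes {n : ℕ} (hn : n ≠ 0) {b : ℝ} (hb : Real.log 2 < b) :
    ∃ δ : ℝ, 0 < δ ∧ δ < 1 / 2 ∧ δ ≤ Real.exp (-(2 * (b - Real.log 2) * 2 ^ n)) ∧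
      ∀ a, markovEntropy n (1 - δ) (1 / 2) ≤ a → a ≤ markovEntropy n δ (1 / 2) →
        ∃ α γ : ℝ, 0 < α ∧ α < 1 ∧ 0 < γ ∧ γ < 1 ∧ markovEntropy n α γ = a ∧
          -(((2 : ℝ) ^ n)⁻¹ * Real.log (α * (1 - α)) +
            (1 - ((2 : ℝ) ^ n)⁻¹) * Real.log (γ * (1 - γ))) / 2 = b := by
  set N : ℝ := 2 ^ n with hN
  have hN2 : 2 ≤ N := by
    rw [hN]; exact le_self_pow₀ (by norm_num) hn
  have hN0 : 0 < N := by linarith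
  set ε : ℝ := N⁻¹ with hε
  have hε0 : 0 < ε := inv_pos.2 hN0
  have hNε : N * ε = 1 := mul_inv_cancel₀ hN0.ne'
  have hε1 : 0 < 1 - ε := by nlinarith
  -- The extreme value of `α (1 - α)`, attained for `γ = 1/2`.
  set A : ℝ := Real.exp (-(2 * (b - Real.log 2) * N)) / 4 with hA
  have hA0 : 0 < A := by positivity
  have hA1 : A < 1 / 4 := by
    have : Real.exp (-(2 * (b - Real.log 2) * N)) < 1 := by
      rw [Real.exp_lt_one_iff]
      have : 0 < 2 * (b - Real.log 2) * N := mul_pos (by linarith) hN0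
      linarith
    rw [hA]; linarith
  have hlogA : Real.log A = -(2 * (b - Real.log 2) * N) - 2 * Real.log 2 := by
    rw [hA, Real.log_div (Real.exp_pos _).ne' (by norm_num), Real.log_exp,
      show (4 : ℝ) = 2 ^ 2 by norm_num, Real.log_pow]
    push_cast; ring
  set S := Real.sqrt (1 - 4 * A) with hS
  have hS2 : S ^ 2 = 1 - 4 * A := Real.sq_sqrt (by linarith)
  have hS0 : 0 < S := Real.sqrt_pos.2 (by linarith)
  have hS1 : S < 1 := by nlinarith
  set δ := (1 - S) / 2 with hδ
  have hδ0 : 0 < δ := by rw [hδ]; linarith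
  have hδh : δ < 1 / 2 := by rw [hδ]; linarith
  have hδA : δ * (1 - δ) = A := by rw [hδ]; nlinarith
  refine ⟨δ, hδ0, hδh, by nlinarith [hA, hA0], fun a ha1 ha2 => ?_⟩
  -- `C α` is the value of `γ (1 - γ)` forced by `α`.
  set C : ℝ → ℝ := fun α => Real.exp ((-2 * b - ε * Real.log (α * (1 - α))) / (1 - ε)) with hC
  set γ : ℝ → ℝ := fun α => (1 + Real.sqrt (1 - 4 * C α)) / 2 with hγ
  have hC0 : ∀ α, 0 < C α := fun α => Real.exp_pos _
  have hCA : ∀ α, α * (1 - α) = A → C α = 1 / 4 := by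
    intro α h
    have e : (-2 * b - ε * Real.log A) / (1 - ε) = Real.log (1 / 4) := by
      rw [div_eq_iff hε1.ne', hlogA, one_div, Real.log_inv, show (4 : ℝ) = 2 ^ 2 by norm_num,
        Real.log_pow]
      push_cast
      linear_combination 2 * (b - Real.log 2) * hNε
    simp only [hC]
    rw [h, e, Real.exp_log (by norm_num)]
  have hge : ∀ α ∈ Set.Icc δ (1 - δ), A ≤ α * (1 - α) := by
    rintro α ⟨h1, h2⟩
    nlinarith [mul_nonneg (sub_nonneg.2 h1) (sub_nonneg.2 h2)]
  have hC4 : ∀ α ∈ Set.Icc δ (1 - δ), C α ≤ 1 / 4 := by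
    intro α h
    rw [← hCA δ hδA]
    refine Real.exp_le_exp.2 (div_le_div_of_nonneg_right ?_ hε1.le)
    have := Real.log_le_log hA0 (hge α h)
    rw [← hδA] at this
    have := mul_le_mul_of_nonneg_left this hε0.le
    linarith
  have hγ0 : ∀ α, 0 < γ α := fun α => by
    have := Real.sqrt_nonneg (1 - 4 * C α)
    simp only [hγ]; linarith
  have hγ1 : ∀ α, γ α < 1 := fun α => by
    have : Real.sqrt (1 - 4 * C α) < 1 := by
      rw [Real.sqrt_lt' one_pos]; linarith [hC0 α]
    simp only [hγ]; linarith
  have hγC : ∀ α ∈ Set.Icc δ (1 - δ), γ α * (1 - γ α) = C α := fun α h => by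
    have := Real.sq_sqrt (show 0 ≤ 1 - 4 * C α by linarith [hC4 α h])
    simp only [hγ]; linarith
  have hγA : ∀ α, α * (1 - α) = A → γ α = 1 / 2 := fun α h => by
    simp only [hγ, hCA α h]; norm_num
  have hcont : ContinuousOn (fun α => markovEntropy n α (γ α)) (Set.Icc δ (1 - δ)) := by
    have hlog : ContinuousOn (fun α : ℝ => Real.log (α * (1 - α))) (Set.Icc δ (1 - δ)) :=
      ContinuousOn.log (by fun_prop) fun α h => (hA0.trans_le (hge α h)).ne'
    have hCc : ContinuousOn C (Set.Icc δ (1 - δ)) := by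
      refine Real.continuous_exp.comp_continuousOn ?_
      exact ((continuousOn_const.sub (continuousOn_const.mul hlog)).div_const _)
    have hγc : ContinuousOn γ (Set.Icc δ (1 - δ)) :=
      ((continuousOn_const.add (Real.continuous_sqrt.comp_continuousOn
        (continuousOn_const.sub (continuousOn_const.mul hCc)))).div_const _)
    have hpc : ContinuousOn (fun α => markovPoint n α (γ α)) (Set.Icc δ (1 - δ)) := by
      unfold markovPoint
      refine ContinuousOn.div (by fun_prop) (by fun_prop) fun α h => ?_
      exact (markovPoint_denom_pos (by linarith [h.2]) (hγ0 α) (hγ1 α)).ne'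
    have hH := Real.binEntropy_continuous
    unfold markovEntropy
    exact (hpc.mul hH.continuousOn).add
      ((continuousOn_const.sub hpc).mul (hH.comp_continuousOn hγc))
  have hδ' : (1 - δ) * (1 - (1 - δ)) = A := by rw [← hδA]; ring
  obtain ⟨α, hα, hαa⟩ := intermediate_value_Icc' (by linarith) hcont
    (show a ∈ Set.Icc _ _ from ⟨by simpa only [hγA _ hδ'] using ha1,
      by simpa only [hγA _ hδA] using ha2⟩)
  refine ⟨α, γ α, hδ0.trans_le hα.1, by linarith [hα.2], hγ0 α, hγ1 α, hαa, ?_⟩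
  rw [hγC α hα]
  simp only [hC]
  rw [Real.log_exp, mul_div_cancel₀ _ hε1.ne']
  ring

/-- Every pair of exponents is attained, for `n` large enough. -/
lemma exists_markov_params {a b : ℝ} (ha : 0 < a) (ha2 : a < Real.log 2) (hb : Real.log 2 < b) :
    ∃ n : ℕ, n ≠ 0 ∧ ∃ α γ : ℝ, 0 < α ∧ α < 1 ∧ 0 < γ ∧ γ < 1 ∧ markovEntropy n α γ = a ∧
      -(((2 : ℝ) ^ n)⁻¹ * Real.log (α * (1 - α)) +
        (1 - ((2 : ℝ) ^ n)⁻¹) * Real.log (γ * (1 - γ))) / 2 = b := by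
  set κ := 2 * (b - Real.log 2) with hκ
  have hκ0 : 0 < κ := by rw [hκ]; linarith
  choose δ hδ using fun n : ℕ => exists_slopes (n := n + 1) (Nat.succ_ne_zero n) hb
  have hpow : Tendsto (fun n : ℕ => (1 / 2 : ℝ) ^ (n + 1)) atTop (𝓝 0) :=
    (tendsto_pow_atTop_nhds_zero_of_lt_one (by norm_num) (by norm_num)).comp
      (tendsto_add_atTop_nat 1)
  -- As `δ n` is superexponentially small, even `2ⁿ⁺¹ δ n` tends to `0`.
  have hexp : ∀ n : ℕ, 2 ^ (n + 1) * δ n ≤ 2 / κ ^ 2 * (1 / 2 : ℝ) ^ (n + 1) := by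
    intro n
    set N : ℝ := 2 ^ (n + 1) with hN
    have hN0 : 0 < N := by positivity
    have h1 := Real.quadratic_le_exp_of_nonneg (mul_pos hκ0 hN0).le
    have h2 : Real.exp (-(κ * N)) ≤ 2 / (κ * N) ^ 2 := by
      rw [Real.exp_neg, ← one_div, div_le_div_iff₀ (Real.exp_pos _) (by positivity)]
      nlinarith [mul_pos hκ0 hN0]
    have h3 : (1 / 2 : ℝ) ^ (n + 1) = N⁻¹ := by rw [one_div, inv_pow]
    calc N * δ n ≤ N * (2 / (κ * N) ^ 2) :=
          mul_le_mul_of_nonneg_left ((hδ n).2.2.1.trans h2) hN0.le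
      _ = _ := by rw [h3]; field_simp
  have hlim1 : Tendsto (fun n : ℕ => (2 : ℝ) ^ (n + 1) * δ n) atTop (𝓝 0) := by
    refine squeeze_zero (fun n => mul_nonneg (by positivity) (hδ n).1.le) hexp ?_
    simpa using hpow.const_mul (2 / κ ^ 2)
  have hlim2 : Tendsto δ atTop (𝓝 0) := by
    refine squeeze_zero (fun n => (hδ n).1.le) (fun n => ?_) hlim1
    exact le_mul_of_one_le_left (hδ n).1.le (one_le_pow₀ (by norm_num))
  have hlow : Tendsto (fun n => Real.binEntropy (δ n) + 2 * 2 ^ (n + 1) * δ n * Real.log 2) atTop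
      (𝓝 0) := by
    have h1 := (Real.binEntropy_continuous.tendsto 0).comp hlim2
    rw [Real.binEntropy_zero] at h1
    have h2 := h1.add (hlim1.const_mul (2 * Real.log 2))
    rw [mul_zero, add_zero] at h2
    refine h2.congr fun n => ?_
    simp only [Function.comp]
    ring
  have hhigh : Tendsto (fun n : ℕ => (1 - 2 * (1 / 2 : ℝ) ^ (n + 1)) * Real.log 2) atTop
      (𝓝 (Real.log 2)) := by
    simpa using ((hpow.const_mul 2).const_sub 1).mul_const (Real.log 2)
  obtain ⟨n, hn1, hn2⟩ :=
    ((hlow.eventually (gt_mem_nhds ha)).and (hhigh.eventually (lt_mem_nhds ha2))).exists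
  obtain ⟨h0, hh, -, hivt⟩ := hδ n
  exact ⟨n + 1, Nat.succ_ne_zero n, hivt a
    ((markovEntropy_half_le (Nat.succ_ne_zero n) h0 hh).trans hn1.le)
    (hn2.le.trans (markovEntropy_half_ge (Nat.succ_ne_zero n) h0 hh))⟩

theorem mainTheorem2 (a b : ℝ) (ha : 0 < a) (ha2 : a < Real.log 2) (hb : Real.log 2 < b) :
    ∃ g : UnitAddCircle → UnitAddCircle,
      Continuous g ∧ IsPiecewiseLinear g ∧ IsExpandingMap g ∧ HasDegree g 2 ∧
        IsWellBehaved g ∧ HasLambdaAbs g a ∧ HasLambdaMax g b := by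
  obtain ⟨n, hn, α, γ, hα0, hα1, hγ0, hγ1, rfl, rfl⟩ := exists_markov_params ha ha2 hb
  let D : BranchParams :=
    { α := α
      γ := γ
      p := markovPoint n α γ
      α_pos := hα0
      α_lt_one := hα1
      γ_pos := hγ0
      γ_lt_one := hγ1
      p_pos := markovPoint_pos hα1 hγ0 hγ1
      p_lt_one := markovPoint_lt_one hn hα1 hγ0 hγ1 }
  have hM : D.IsMarkov n := D.isMarkov_of_eq rfl
  exact ⟨D.map, D.continuous_map, D.isPiecewiseLinear_map, D.isExpandingMap_map, D.hasDegree_map,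
    hM.hasLambdaAbs.1, hM.hasLambdaAbs, hM.hasLambdaMax⟩
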